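/- **Setting and notation.** Logarithms are natural. For $n\ge 1$ let $\mu$ be a Borel probability measure on $\mathbb{R}^n$. It is *unconditional* if $(x_1,\dots,x_n)$ and $(\varepsilon_1x_1,\dots,\varepsilon_nx_n)$ have the same law under $\mu$ for all signs $\varepsilon_i\in\{-1,1\}$, and it satisfies the *$p$-small diameter assumption* with constant $\kappa_1$ if $\|x\|_{\ell_p^n}\le\kappa_1n^{1/p}$ for $\mu$-almost every $x$. Let $B_2^n$ be the closed Euclidean unit ball. Given $\kappa_4\geq 10$ and an integer $s_1\ge 0$, put for $s\ge 0$ $$\eta_s=\kappa_4\,2^{s+s_1}\max\{\log(en/2^{s+s_1}),1\}.$$ An *$(\eta_s)$-admissible sequence* of $B_2^n$ consists of finite sets $T_s\subset B_2^n$ with $|T_s|\le 2^{\eta_s}$, $s\ge 0$, together with maps $\pi_s:B_2^n\to T_s$ such that $\pi_st\to t$ as $s\to\infty$ for every $t\in B_2^n$. Put $\Delta_0t=\pi_0t$ and $\Delta_st=\pi_st-\pi_{s-1}t$ for $s\ge1$, so that $t=\sum_{s\ge0}\Delta_st$. For $c,u>0$ let $\theta_{u,s}$ be the following functionals of $\langle\Delta_st,\cdot\rangle$,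 which are constants: $$\theta_{u,0}=c\sqrt u\,\eta_0^{1/2}n^{1/p}2^{s_1(1/2-1/p)},$$ and for $s\ge1$ $$\theta_{u,s}=\begin{cases}c\sqrt u\,\eta_s^{1/2}n^{1/p}2^{-(s+s_1)/p}&\text{if }2^{s+s_1}\le n,\\ c\sqrt u\,\eta_s^{1/2}2^{-2^{s+s_1}/n}&\text{if }2^{s+s_1}>n.\end{cases}$$ Let $N\ge 1$ be an integer and let $X=(X_1,\dots,X_N)$ be distributed according to $\mu^N$. Let $s_0$ be the first integer with $\eta_{s_0}\geq\log(eN)$. Let $\ell_s=1$ if $\eta_s\le\log(eN)$, and otherwise let $\ell_s$ be the largest $\ell\in\{1,\dots,N\}$ with $\ell\log(eN/\ell)\le\eta_s$ (so $\ell_s=N$ if $\eta_s\ge N$). For $a\in\mathbb{R}^N$ let $(a_i^*)_{i=1}^N$ be the non-increasing rearrangement of $(|a_i|)_{i=1}^N$; a sum $\sum_{i=1}^{r}a_i^*$ with real $r$ runs over the integers $1\le i\le\min\{r,N\}$. Let $\Omega_{1,u}$ be the event that for every $t\in B_2^n$: 1. for every $s$ with $\log(eN)\le\eta_s\le N$,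 $\Big(\sum_{i=1}^{u\ell_{s+1}}(\langle\Delta_st,X_i\rangle^2)^*\Big)^{1/2}\le\theta_{u,s}$; 2. for every $s$ with $\eta_s>N$, $\Big(\sum_{i=1}^{N}(\langle\Delta_st,X_i\rangle^2)^*\Big)^{1/2}\le\theta_{u,s}$; 3. $\Big(\sum_{i=1}^{u\ell_{s_0+1}}(\langle\pi_{s_0}t,X_i\rangle^2)^*\Big)^{1/2}\le\theta_{u,s_0}$. **Theorem.** There is an absolute constant $\kappa_4\ge10$ for which the following holds. For every $\kappa_1>0$, $p>2$ and $0<\delta<\frac12-\frac1{2(p-1)}$ there are positive constants $c,c_1,c_2,c_3$ depending only on $\kappa_1,p,\delta$ such that, for every $n\ge1$, every integer $s_1\ge0$ with $\frac12n^\delta\le2^{s_1}\le2n^\delta$, and every unconditional probability measure $\mu$ on $\mathbb{R}^n$ that satisfies the $p$-small diameter assumption with constant $\kappa_1$, the ball $B_2^n$ has an $(\eta_s)$-admissible sequence for which, for every $u\ge c_1$, $$\Pr(\Omega_{1,u})\ge1-\exp(-c_2n^\delta)\quad\text{for every integer }N\ge1\text{ with }\log(eN)\le\eta_0,$$ and $$\sup_{t\in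 B_2^n}\sum_{s\ge0}\theta_{u,s}(\langle\Delta_st,\cdot\rangle)\le c_3\sqrt u\,\sqrt n .$$ -/

import Mathlib

open MeasureTheory Filter Topology

noncomputable section

namespace BallChaining

/-- A measure on `ℝⁿ` is unconditional if `(ε₁x₁, …, εₙxₙ)` has the same law as `(x₁, …, xₙ)`
for every choice of signs `εᵢ ∈ {-1, 1}`. -/
def IsUnconditional {n : ℕ} (μ : Measure (EuclideanSpace ℝ (Fin n))) : Prop :=
  ∀ ε : Fin n → ℝ, (∀ i, ε i = 1 ∨ ε i = -1) →
    μ.map (fun x : EuclideanSpace ℝ (Fin n) => WithLp.toLp 2 (fun i => ε i * x i)) = μ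

/-- The `p`-small diameter assumption: `‖X‖_{ℓ_pⁿ} ≤ κ₁ n^{1/p}` almost surely. -/
def HasSmallDiameter {n : ℕ} (μ : Measure (EuclideanSpace ℝ (Fin n))) (p κ₁ : ℝ) : Prop :=
  ∀ᵐ x ∂μ, (∑ i, |x i| ^ p) ^ (1 / p) ≤ κ₁ * (n : ℝ) ^ (1 / p)

/-- `(T_s)` is an admissible sequence of `V` relative to `(η_s)`, with maps `π_s : V → T_s`
whose chains converge, i.e. `v = π_0 v + ∑_{s ≥ 1} (π_s v - π_{s-1} v)` for every `v ∈ V`. -/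
structure IsAdmissible {E : Type*} [TopologicalSpace E] (η : ℕ → ℝ) (V : Set E)
    (T : ℕ → Finset E) (π : ℕ → E → E) : Prop where
  subset : ∀ s, (T s : Set E) ⊆ V
  card_le : ∀ s, ((T s).card : ℝ) ≤ (2 : ℝ) ^ (η s)
  maps_to : ∀ s, ∀ v ∈ V, π s v ∈ T s
  tendsto : ∀ v ∈ V, Tendsto (fun s => π s v) atTop (𝓝 v)

/-- `Δ_s v = π_s v - π_{s-1} v` for `s ≥ 1`, and `Δ_0 v = π_0 v`. -/
def increment {E : Type*} [AddCommGroup E] (π : ℕ → E → E) : ℕ → E → E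
  | 0, v => π 0 v
  | s + 1, v => π (s + 1) v - π s v

/-- The non-increasing rearrangement `(a_i^*)` of `(|a_i|)`. -/
def rearrangement {N : ℕ} (a : Fin N → ℝ) (i : Fin N) : ℝ :=
  |a (Tuple.sort (fun j => |a j|) i.rev)|

/-- `∑_{1 ≤ i ≤ r} a_i^*` for real `r`; the sum terminates at `N` if `r > N`. The 1-based index
of `i : Fin N` is `i + 1`. -/
def sumLargest {N : ℕ} (a : Fin N → ℝ) (r : ℝ) : ℝ :=
  ∑ i ∈ Finset.univ.filter (fun i : Fin N => (i.val : ℝ) + 1 ≤ r), rearrangement a i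

/-- `s_0`, the first integer with `η_s ≥ log (eN)`. -/
def firstLevel (N : ℕ) (η : ℕ → ℝ) : ℕ :=
  sInf {s : ℕ | Real.log (Real.exp 1 * N) ≤ η s}

/-- `ℓ_s`: equal to `1` if `η_s ≤ log (eN)`, and otherwise the largest `ℓ ∈ {1, …, N}` with
`ℓ log (eN/ℓ) ≤ η_s` (which is `N` as soon as `η_s ≥ N`). -/
def levelSize (N : ℕ) (η : ℕ → ℝ) (s : ℕ) : ℕ :=
  if η s ≤ Real.log (Real.exp 1 * N) then 1
  else ((Finset.Icc 1 N).filter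
    (fun l : ℕ => (l : ℝ) * Real.log (Real.exp 1 * N / l) ≤ η s)).sup id

/-- The event `Ω_{1,u}` in the `N`-fold product of `ℝⁿ`, for the class of linear functionals
`⟨t, ·⟩`, `t ∈ V`. Functionals are identified with the vectors that represent them, so `θ s`
is a function of a vector. -/
def eventOne {n : ℕ} (N : ℕ) (η : ℕ → ℝ) (V : Set (EuclideanSpace ℝ (Fin n)))
    (π : ℕ → EuclideanSpace ℝ (Fin n) → EuclideanSpace ℝ (Fin n))
    (θ : ℕ → EuclideanSpace ℝ (Fin n) → ℝ) (u : ℝ) :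
    Set (Fin N → EuclideanSpace ℝ (Fin n)) :=
  {X | ∀ t ∈ V,
    (∀ s, Real.log (Real.exp 1 * N) ≤ η s → η s ≤ N →
      √(sumLargest (fun i => (inner ℝ (increment π s t) (X i)) ^ 2)
        (u * levelSize N η (s + 1))) ≤ θ s (increment π s t)) ∧
    (∀ s, (N : ℝ) < η s →
      √(sumLargest (fun i => (inner ℝ (increment π s t) (X i)) ^ 2) N)
        ≤ θ s (increment π s t)) ∧
    √(sumLargest (fun i => (inner ℝ (π (firstLevel N η) t) (X i)) ^ 2)
        (u * levelSize N η (firstLevel N η + 1)))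
      ≤ θ (firstLevel N η) (π (firstLevel N η) t)}

/-- `η_s = κ₄ 2^{s+s₁} max {log (en / 2^{s+s₁}), 1}`. -/
def eta (κ₄ : ℝ) (n s₁ s : ℕ) : ℝ :=
  κ₄ * 2 ^ (s + s₁) * max (Real.log (Real.exp 1 * n / 2 ^ (s + s₁))) 1

/-- The functionals `θ_{u,s}` on linear functionals (identified with vectors), which are constants
depending only on `u` and `s` (and on the parameters `c, κ₄, p, n, s₁`). -/
def theta (c κ₄ p : ℝ) (n s₁ : ℕ) (u : ℝ) :
    ℕ → EuclideanSpace ℝ (Fin n) → ℝ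
  | 0, _ => c * √u * √(eta κ₄ n s₁ 0) * (n : ℝ) ^ (1 / p) *
      ((2 : ℝ) ^ s₁) ^ (1 / 2 - 1 / p)
  | s + 1, _ =>
      if 2 ^ (s + 1 + s₁) ≤ n then
        c * √u * √(eta κ₄ n s₁ (s + 1)) * (n : ℝ) ^ (1 / p) *
          ((2 : ℝ) ^ (s + 1 + s₁)) ^ (-(1 / p))
      else
        c * √u * √(eta κ₄ n s₁ (s + 1)) * (2 : ℝ) ^ (-((2 : ℝ) ^ (s + 1 + s₁) / n))

end BallChaining

end

open BallChaining

open BallChaining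

/-! The chain is coordinatewise rounding. At level `s`, with `m = 2^(s+s₁)`, every `t` is rounded
towards zero onto a grid of squared inverse mesh `R = m` when `m ≤ n` and `R = n 2^(4m/n)` beyond.
Grid points of the ball are integer vectors of squared norm at most `R`, and a generating function
argument shows that there are at most `2^(η_s)` of them (`card_latticeBall_le`,
`isAdmissible_ball`).

The coordinates of `Δ_s t` are `O(R^(-1/2))` with `R` taken at level `s-1`, and rounding does not
lengthen vectors. Hölder's inequality and the small diameter assumption therefore bound `∑ (Δ_s
t)_i² x_i²` by a constant times the square of `widthBound` (`sum_increment_sq_le`). By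
unconditionality `⟨Δ_s t, X⟩` is a Rademacher sum given `|X_i|`, so this bound is its subgaussian
variance proxy (`lintegral_exp_inner_sq_le`). A large deviation estimate, uniform over all small
sets of sample points (`measure_exists_sum_sq_le`), then survives the union bound over the
increments and the levels.

In the sum of `θ`, the terms with `s ≥ 1` decay geometrically on both sides of `m = n`, where they
are of order `√n`. The restriction on `δ` is what the term `s = 0` needs (`sqrt_eta_zero_mul_le`).
-/

/-! ### Square-exponential moments of unconditional laws. -/

/-- The sign attached to a Boolean. -/
def boolSign (b : Bool) : ℝ := if b then 1 else -1

lemma boolSign_eq (b : Bool) : boolSign b = 1 ∨ boolSign b = -1 := by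
  cases b <;> simp [boolSign]

/-- Averaging one sign in a squared-exponential. -/
lemma exp_sq_add_exp_sq_le {l : ℝ} (y a : ℝ) :
    Real.exp (l * (y + a) ^ 2) + Real.exp (l * (y - a) ^ 2) ≤
      2 * (Real.exp (l * a ^ 2) * Real.exp (l * (1 + 2 * l * a ^ 2) * y ^ 2)) := by
  have h := Real.cosh_le_exp_half_sq (2 * l * y * a)
  have e1 : Real.exp (l * (y + a) ^ 2) + Real.exp (l * (y - a) ^ 2) =
      2 * (Real.exp (l * a ^ 2) * (Real.exp (l * y ^ 2) * Real.cosh (2 * l * y * a))) := by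
    rw [Real.cosh_eq]
    have h1 : l * (y + a) ^ 2 = l * a ^ 2 + l * y ^ 2 + 2 * l * y * a := by ring
    have h2 : l * (y - a) ^ 2 = l * a ^ 2 + l * y ^ 2 + -(2 * l * y * a) := by ring
    rw [h1, h2, Real.exp_add, Real.exp_add, Real.exp_add (l * a ^ 2 + l * y ^ 2), Real.exp_add]
    ring
  have e2 : Real.exp (l * (1 + 2 * l * a ^ 2) * y ^ 2) =
      Real.exp (l * y ^ 2) * Real.exp ((2 * l * y * a) ^ 2 / 2) := by
    rw [← Real.exp_add]; congr 1; ring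
  rw [e1, e2]
  gcongr

/-- Square-exponential moments of Rademacher sums. -/
lemma sum_signs_exp_sq_le : ∀ (n : ℕ) (a : Fin n → ℝ) (l : ℝ), 0 ≤ l →
    2 * l * ∑ i, a i ^ 2 < 1 →
    ∑ ε : Fin n → Bool, Real.exp (l * (∑ i, boolSign (ε i) * a i) ^ 2) ≤
      2 ^ n * Real.exp (l * (∑ i, a i ^ 2) / (1 - 2 * l * ∑ i, a i ^ 2)) := by
  intro n
  induction n with
  | zero => intro a l _ _; simp
  | succ n ih =>
    intro a l hl h
    rw [← (Fin.consEquiv (fun _ => Bool)).sum_comp, Fintype.sum_prod_type_right]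
    simp only [Fin.consEquiv, Equiv.coe_fn_mk, Fin.sum_univ_succ, Fin.cons_zero, Fin.cons_succ,
      Fintype.sum_bool] at h ⊢
    set q : ℝ := ∑ i : Fin n, a i.succ ^ 2 with hq
    have hq0 : 0 ≤ q := Finset.sum_nonneg fun i _ => sq_nonneg _
    set b := a 0 ^ 2 with hb
    have hb0 : 0 ≤ b := sq_nonneg _
    set l' := l * (1 + 2 * l * b) with hl'
    have hl'0 : 0 ≤ l' := by positivity
    have hlq : 0 ≤ l * q := by positivity
    have hlb : 0 ≤ l * b := by positivity
    have hden : 0 < 1 - 2 * l * (b + q) := by linarith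
    have hb1 : 0 < 1 - 2 * l * b := by nlinarith
    -- The reciprocal of the right side is `1/l - 2b`. Each averaged sign thus uses up its own
    -- square in the budget `1/l`, which is why the closed form survives the induction.
    have hl'le : l' ≤ l / (1 - 2 * l * b) := by
      rw [le_div_iff₀ hb1, hl']
      nlinarith [mul_nonneg hl (sq_nonneg (l * b))]
    have hl'q : l' * q ≤ l * q / (1 - 2 * l * b) := by
      calc l' * q ≤ l / (1 - 2 * l * b) * q := by gcongr
        _ = _ := by ring
    have hlt : 2 * l' * q < 1 := by
      have : l * q / (1 - 2 * l * b) < 1 / 2 := by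
        rw [div_lt_div_iff₀ hb1 two_pos]; nlinarith
      nlinarith
    have hd2 : 0 < 1 - 2 * l' * q := by linarith
    have key : l * b + l' * q / (1 - 2 * l' * q) ≤ l * (b + q) / (1 - 2 * l * (b + q)) := by
      have h1 : l' * q / (1 - 2 * l' * q) ≤ l * q / (1 - 2 * l * (b + q)) := by
        rw [le_div_iff₀ hb1] at hl'q
        rw [div_le_div_iff₀ hd2 hden]
        nlinarith
      have h2 : l * b ≤ l * b / (1 - 2 * l * (b + q)) := by
        rw [le_div_iff₀ hden]; nlinarith
      calc _ ≤ l * b / (1 - 2 * l * (b + q)) + l * q / (1 - 2 * l * (b + q)) := add_le_add h2 h1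
        _ = _ := by ring
    calc ∑ x : Fin n → Bool, (Real.exp (l * (boolSign true * a 0 +
            ∑ i, boolSign (x i) * a i.succ) ^ 2) +
          Real.exp (l * (boolSign false * a 0 + ∑ i, boolSign (x i) * a i.succ) ^ 2))
        ≤ ∑ x : Fin n → Bool, 2 * (Real.exp (l * b) *
          Real.exp (l' * (∑ i, boolSign (x i) * a i.succ) ^ 2)) := by
          refine Finset.sum_le_sum fun x _ => ?_
          have := exp_sq_add_exp_sq_le (l := l) (∑ i, boolSign (x i) * a i.succ) (a 0)
          refine le_trans (le_of_eq ?_) this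
          simp only [boolSign]
          norm_num
          congr 2 <;> ring_nf
      _ = 2 * Real.exp (l * b) * ∑ x : Fin n → Bool,
          Real.exp (l' * (∑ i, boolSign (x i) * a i.succ) ^ 2) := by
          rw [Finset.mul_sum]; exact Finset.sum_congr rfl fun _ _ => by ring
      _ ≤ 2 * Real.exp (l * b) * (2 ^ n * Real.exp (l' * q / (1 - 2 * l' * q))) := by
          gcongr
          exact ih (fun i => a i.succ) l' hl'0 hlt
      _ = 2 ^ (n + 1) * Real.exp (l * b + l' * q / (1 - 2 * l' * q)) := by
          rw [Real.exp_add]; ring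
      _ ≤ _ := by gcongr

/-- An unconditional law whose weighted coordinates are bounded in `ℓ₂` has a sub-gaussian
square-exponential moment. -/
lemma lintegral_exp_inner_sq_le {n : ℕ} {μ : Measure (EuclideanSpace ℝ (Fin n))}
    [IsProbabilityMeasure μ] (hμ : IsUnconditional μ) (v : EuclideanSpace ℝ (Fin n)) {q : ℝ}
    (hq : 0 < q) (hv : ∀ᵐ x ∂μ, ∑ i, v i ^ 2 * x i ^ 2 ≤ q) :
    ∫⁻ x, ENNReal.ofReal (Real.exp (1 / (4 * q) * (inner ℝ v x) ^ 2)) ∂μ ≤ 2 := by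
  set F : EuclideanSpace ℝ (Fin n) → ENNReal :=
    fun x => ENNReal.ofReal (Real.exp (1 / (4 * q) * (inner ℝ v x) ^ 2)) with hF
  have hFm : Measurable F := by
    have : Continuous fun x : EuclideanSpace ℝ (Fin n) =>
      Real.exp (1 / (4 * q) * (inner ℝ v x) ^ 2) := by fun_prop
    exact this.measurable.ennreal_ofReal
  let flip (ε : Fin n → Bool) (x : EuclideanSpace ℝ (Fin n)) : EuclideanSpace ℝ (Fin n) :=
    WithLp.toLp 2 (fun i => boolSign (ε i) * x i)
  have hflip : ∀ ε, Measurable (flip ε) := fun ε => by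
    have : Continuous (flip ε) := by fun_prop
    exact this.measurable
  -- Sign flips preserve the integral, so it may be averaged over all signs; for a fixed `x` that
  -- average is a Rademacher moment.
  have h1 : ∀ ε, ∫⁻ x, F (flip ε x) ∂μ = ∫⁻ x, F x ∂μ := fun ε => by
    rw [← lintegral_map hFm (hflip ε)]
    congr 1
    exact hμ (fun i => boolSign (ε i)) fun i => boolSign_eq _
  have h2 : (2 : ENNReal) ^ n * ∫⁻ x, F x ∂μ = ∫⁻ x, ∑ ε, F (flip ε x) ∂μ := by
    rw [lintegral_finsetSum (f := fun ε x => F (flip ε x)) _ fun ε _ => hFm.comp (hflip ε)]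
    simp [h1]
  have h3 : ∫⁻ x, ∑ ε, F (flip ε x) ∂μ ≤ ∫⁻ _, (2 : ENNReal) ^ n * 2 ∂μ := by
    refine lintegral_mono_ae ?_
    filter_upwards [hv] with x hx
    have e : ∀ ε, (inner ℝ v (flip ε x) : ℝ) = ∑ i, boolSign (ε i) * (v i * x i) := fun ε => by
      simp only [PiLp.inner_apply, flip, RCLike.inner_apply, conj_trivial]
      exact Finset.sum_congr rfl fun i _ => by ring
    set t := ∑ i, (v i * x i) ^ 2 with ht
    have htq : t ≤ q := by simpa [ht, mul_pow] using hx
    have ht0 : 0 ≤ t := Finset.sum_nonneg fun i _ => sq_nonneg _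
    have hlt : 1 / (4 * q) * t ≤ 1 / 4 := by
      rw [div_mul_eq_mul_div, div_le_div_iff₀ (by positivity) (by norm_num)]; linarith
    have hs := sum_signs_exp_sq_le n (fun i => v i * x i) (1 / (4 * q)) (by positivity)
      (by rw [mul_assoc]; linarith)
    have hfrac : 1 / (4 * q) * t / (1 - 2 * (1 / (4 * q)) * t) ≤ 1 / 2 := by
      rw [div_le_div_iff₀ (by rw [mul_assoc]; linarith) two_pos, mul_assoc 2]; linarith
    have he : Real.exp (1 / 2) ≤ 2 := by
      have h := Real.exp_one_lt_d9
      have : Real.exp (1 / 2) ^ 2 = Real.exp 1 := by rw [← Real.exp_nat_mul]; norm_num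
      nlinarith [Real.exp_pos (1 / 2)]
    simp only [hF, e]
    rw [← ENNReal.ofReal_sum_of_nonneg fun _ _ => (Real.exp_pos _).le]
    refine ENNReal.ofReal_le_of_le_toReal ?_
    simp only [ENNReal.toReal_mul, ENNReal.toReal_pow, ENNReal.toReal_ofNat]
    refine hs.trans ?_
    gcongr
    exact (Real.exp_le_exp.mpr hfrac).trans he
  rw [lintegral_const, measure_univ, mul_one, ← h2] at h3
  exact (ENNReal.mul_le_mul_iff_right (by simp) (by simp)).mp h3

/-! ### Large deviations over small sets of sample points. -/

/-- Large deviations for the sum of squares over the worst set of at most `ρ` coordinates. -/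
lemma measure_exists_sum_sq_le {n N : ℕ} {μ : Measure (EuclideanSpace ℝ (Fin n))}
    [IsProbabilityMeasure μ] (hμ : IsUnconditional μ) (v : EuclideanSpace ℝ (Fin n)) {q : ℝ}
    (hq : 0 < q) (hv : ∀ᵐ x ∂μ, ∑ i, v i ^ 2 * x i ^ 2 ≤ q) {ρ : ℝ} (hρ : 0 < ρ)
    (hρN : ρ ≤ N) (A : ℝ) :
    Measure.pi (fun _ : Fin N => μ)
      {X | ∃ J : Finset (Fin N), (J.card : ℝ) ≤ ρ ∧ A < ∑ j ∈ J, (inner ℝ v (X j)) ^ 2} ≤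
      ENNReal.ofReal (Real.exp (-(A / (4 * q)) + 2 * (ρ * Real.log (Real.exp 1 * N / ρ)))) := by
  have hN : (0 : ℝ) < N := hρ.trans_le hρN
  set w : ℝ := ρ / N with hw
  have hw0 : 0 < w := by positivity
  have hw1 : w ≤ 1 := (div_le_one hN).mpr hρN
  set G : EuclideanSpace ℝ (Fin n) → ℝ := fun x => Real.exp (1 / (4 * q) * (inner ℝ v x) ^ 2)
    with hG
  have hGc : Continuous G := by fun_prop
  have hG0 : ∀ x, 0 < G x := fun x => Real.exp_pos _
  have hlin := lintegral_exp_inner_sq_le hμ v hq hv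
  have hGi : Integrable G μ := by
    refine ⟨hGc.aestronglyMeasurable, ?_⟩
    rw [hasFiniteIntegral_iff_ofReal (ae_of_all _ fun x => (hG0 x).le)]
    exact hlin.trans_lt (by simp)
  have hGint : ∫ x, G x ∂μ ≤ 2 := by
    rw [integral_eq_lintegral_of_nonneg_ae (ae_of_all _ fun x => (hG0 x).le)
      hGc.aestronglyMeasurable]
    exact ENNReal.toReal_le_of_le_ofReal (by norm_num) (by rw [ENNReal.ofReal_ofNat]; exact hlin)
  have hHi : Integrable (fun x => 1 + w * G x) μ := (integrable_const _).add (hGi.const_mul w)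
  -- Expanding the product gives every `∏ j ∈ J, w * G (X j)`, so one application of Markov's
  -- inequality handles all `J` at once. The weight `w = ρ/N` keeps the mean below `exp (2ρ)` and
  -- charges at most `ρ log (N/ρ)` for the choice of `J`.
  set P : (Fin N → EuclideanSpace ℝ (Fin n)) → ℝ := fun X => ∏ j, (1 + w * G (X j)) with hP
  have hPi : Integrable P (Measure.pi fun _ : Fin N => μ) :=
    Integrable.fintype_prod (f := fun _ x => 1 + w * G x) fun _ => hHi
  have hP0 : ∀ X, 0 ≤ P X := fun X => Finset.prod_nonneg fun j _ => by
    have := hG0 (X j); positivity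
  have hPint : ∫ X, P X ∂(Measure.pi fun _ : Fin N => μ) ≤ Real.exp (2 * ρ) := by
    rw [hP, integral_fintype_prod_eq_prod (f := fun _ x => 1 + w * G x)]
    have h1 : ∫ x, (1 + w * G x) ∂μ ≤ Real.exp (2 * w) := by
      rw [integral_add (integrable_const _) (hGi.const_mul w), integral_const_mul]
      simp only [integral_const, probReal_univ, smul_eq_mul, mul_one]
      have := Real.add_one_le_exp (2 * w)
      nlinarith
    have h0 : 0 ≤ ∫ x, (1 + w * G x) ∂μ := integral_nonneg fun x => by
      have := hG0 x; simp only [Pi.zero_apply]; positivity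
    calc _ = (∫ x, (1 + w * G x) ∂μ) ^ N := by simp
      _ ≤ Real.exp (2 * w) ^ N := by gcongr
      _ = Real.exp (2 * ρ) := by
        rw [← Real.exp_nat_mul, hw]; congr 1; field_simp
  set B : ℝ := Real.exp (A / (4 * q) + ρ * Real.log w) with hB
  have hsub : {X : Fin N → EuclideanSpace ℝ (Fin n) | ∃ J : Finset (Fin N), (J.card : ℝ) ≤ ρ ∧
      A < ∑ j ∈ J, (inner ℝ v (X j)) ^ 2} ⊆ {X | B ≤ P X} := by
    rintro X ⟨J, hJ, hA⟩
    have hlog : Real.log w ≤ 0 := Real.log_nonpos hw0.le hw1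
    calc B ≤ Real.exp (1 / (4 * q) * ∑ j ∈ J, (inner ℝ v (X j)) ^ 2 + J.card * Real.log w) := by
          refine Real.exp_le_exp.mpr (add_le_add ?_ ?_)
          · rw [div_eq_inv_mul, ← one_div]; gcongr
          · exact mul_le_mul_of_nonpos_right hJ hlog
      _ = ∏ j ∈ J, (w * G (X j)) := by
          rw [Real.exp_add, Finset.mul_sum, Real.exp_sum, Finset.prod_mul_distrib,
            Finset.prod_const, Real.exp_nat_mul, Real.exp_log hw0]
          ring
      _ ≤ ∏ j ∈ J, (1 + w * G (X j)) := Finset.prod_le_prod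
          (fun j _ => mul_nonneg hw0.le (hG0 _).le) fun j _ => by linarith
      _ ≤ P X := by
          have h1 : ∀ j, 1 ≤ 1 + w * G (X j) := fun j => by
            have := mul_pos hw0 (hG0 (X j)); linarith
          simp only [hP]
          rw [← Finset.prod_mul_prod_compl J]
          exact le_mul_of_one_le_right (Finset.prod_nonneg fun j _ => zero_le_one.trans (h1 j))
            (Finset.one_le_prod fun j _ => h1 j)
  have hmark := mul_meas_ge_le_integral_of_nonneg (ae_of_all _ hP0) hPi B
  have hB0 : 0 < B := Real.exp_pos _
  refine (measure_mono hsub).trans ?_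
  rw [← ofReal_measureReal]
  refine ENNReal.ofReal_le_ofReal ?_
  have h1 : (Measure.pi fun _ : Fin N => μ).real {X | B ≤ P X} ≤ Real.exp (2 * ρ) / B := by
    rw [le_div_iff₀ hB0, mul_comm]; exact hmark.trans hPint
  refine h1.trans (le_of_eq ?_ |>.trans (Real.exp_le_exp.mpr ?_) (b := Real.exp (2 * ρ - (A / (4 * q) + ρ * Real.log w))))
  · rw [Real.exp_sub]
  · have e : Real.log (Real.exp 1 * N / ρ) = 1 - Real.log w := by
      rw [hw, Real.log_div (by positivity) hρ.ne', Real.log_mul (Real.exp_pos 1).ne' hN.ne',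
        Real.log_exp, Real.log_div hρ.ne' hN.ne']; ring
    have hlog : Real.log w ≤ 0 := Real.log_nonpos hw0.le hw1
    rw [e]; nlinarith

/-! ### Counting lattice points in Euclidean balls. -/

/-- Integer vectors with squared Euclidean norm at most `R`. -/
noncomputable def latticeBall (n : ℕ) (R : ℝ) : Finset (Fin n → ℤ) :=
  (Fintype.piFinset fun _ => Finset.Icc (-⌊R⌋) ⌊R⌋).filter fun k => ((∑ i, k i ^ 2 : ℤ) : ℝ) ≤ R

/-- Allows `x ^ |k|` in place of `x ^ k²` in the generating function, which then becomes a geometric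
series. -/
lemma abs_le_sq_int (k : ℤ) : |k| ≤ k ^ 2 := by
  rw [← sq_abs]
  rcases (abs_nonneg k).eq_or_lt with h | h
  · rw [← h]; norm_num
  · nlinarith

lemma mem_latticeBall {n : ℕ} {R : ℝ} {k : Fin n → ℤ} :
    k ∈ latticeBall n R ↔ ((∑ i, k i ^ 2 : ℤ) : ℝ) ≤ R := by
  simp only [latticeBall, Finset.mem_filter, Fintype.mem_piFinset, Finset.mem_Icc,
    and_iff_right_iff_imp]
  intro h i
  rw [← abs_le]
  refine (abs_le_sq_int _).trans (Int.le_floor.mpr (le_trans ?_ h))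
  exact_mod_cast Finset.single_le_sum (f := fun i => k i ^ 2) (fun i _ => sq_nonneg _)
    (Finset.mem_univ i)

lemma sum_Icc_neg_pow_natAbs (x : ℝ) (M : ℕ) :
    ∑ j ∈ Finset.Icc (-(M : ℤ)) M, x ^ j.natAbs =
      1 + 2 * x * ∑ j ∈ Finset.range M, x ^ j := by
  induction M with
  | zero => simp
  | succ M ih =>
    have h : Finset.Icc (-((M + 1 : ℕ) : ℤ)) ((M + 1 : ℕ) : ℤ) =
        insert (((M + 1 : ℕ) : ℤ)) (insert (-((M + 1 : ℕ) : ℤ))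
          (Finset.Icc (-(M : ℤ)) M)) := by
      ext j; simp only [Finset.mem_Icc, Finset.mem_insert]; push_cast; omega
    rw [h, Finset.sum_insert, Finset.sum_insert, ih, Finset.sum_range_succ]
    · simp only [Int.natAbs_neg, Int.natAbs_natCast]; ring
    · simp only [Finset.mem_Icc]; push_cast; omega
    · simp only [Finset.mem_Icc, Finset.mem_insert]; push_cast; omega

lemma sum_Icc_pow_natAbs_le {x : ℝ} (hx0 : 0 ≤ x) (hx1 : x < 1) {R : ℝ} (hR : 0 ≤ R) :
    ∑ j ∈ Finset.Icc (-⌊R⌋) ⌊R⌋, x ^ j.natAbs ≤ 1 + 2 * x / (1 - x) := by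
  obtain ⟨M, hM⟩ := Int.eq_ofNat_of_zero_le (Int.floor_nonneg.mpr hR)
  rw [hM]
  rw [sum_Icc_neg_pow_natAbs, mul_div_assoc, mul_assoc]
  have : ∑ j ∈ Finset.range M, x ^ j ≤ 1 / (1 - x) := by
    rw [geom_sum_eq hx1.ne, ← neg_div_neg_eq, neg_sub, neg_sub]
    have : 0 < 1 - x := by linarith
    gcongr
    have := pow_nonneg hx0 M
    linarith
  have h2 := mul_le_mul_of_nonneg_left this hx0
  rw [mul_one_div] at h2
  linarith

/-- The exponential (generating function) bound for the number of lattice points. -/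
lemma card_latticeBall_le (n : ℕ) {R x : ℝ} (hR : 0 ≤ R) (hx0 : 0 < x) (hx1 : x < 1) :
    ((latticeBall n R).card : ℝ) ≤ x ^ (-R) * (1 + 2 * x / (1 - x)) ^ n := by
  have h1 : ∀ k ∈ latticeBall n R, (1 : ℝ) ≤ x ^ (-R) * ∏ i, x ^ (k i).natAbs := by
    intro k hk
    rw [mem_latticeBall] at hk
    rw [Finset.prod_pow_eq_pow_sum, ← Real.rpow_natCast, ← Real.rpow_add hx0]
    refine Real.one_le_rpow_of_pos_of_le_one_of_nonpos hx0 hx1.le ?_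
    have : ((∑ i, (k i).natAbs : ℕ) : ℤ) ≤ ∑ i, k i ^ 2 := by
      push_cast
      exact Finset.sum_le_sum fun i _ => abs_le_sq_int _
    have h' : ((∑ i, (k i).natAbs : ℕ) : ℝ) ≤ ((∑ i, k i ^ 2 : ℤ) : ℝ) := by
      rw [← Int.cast_natCast]; exact Int.cast_le.mpr this
    linarith
  calc ((latticeBall n R).card : ℝ) = ∑ k ∈ latticeBall n R, (1 : ℝ) := by simp
    _ ≤ ∑ k ∈ latticeBall n R, x ^ (-R) * ∏ i, x ^ (k i).natAbs := Finset.sum_le_sum h1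
    _ ≤ ∑ k ∈ Fintype.piFinset fun _ : Fin n => Finset.Icc (-⌊R⌋) ⌊R⌋,
        x ^ (-R) * ∏ i, x ^ (k i).natAbs :=
        Finset.sum_le_sum_of_subset_of_nonneg (Finset.filter_subset _ _) fun _ _ _ => by positivity
    _ = x ^ (-R) * (∑ j ∈ Finset.Icc (-⌊R⌋) ⌊R⌋, x ^ j.natAbs) ^ n := by
        rw [← Finset.mul_sum, ← Finset.prod_univ_sum (fun _ : Fin n => Finset.Icc (-⌊R⌋) ⌊R⌋)
          (fun _ j => x ^ j.natAbs)]
        simp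
    _ ≤ _ := by
        gcongr
        exact sum_Icc_pow_natAbs_le hx0.le hx1 hR

/-- The squared inverse mesh at dimension `m`. -/
noncomputable def invMeshSq (n : ℕ) (m : ℝ) : ℝ := if m ≤ n then m else n * 2 ^ (4 * m / n)

lemma exp_one_le_four : Real.exp 1 ≤ 4 := by have := Real.exp_one_lt_d9; linarith

lemma card_latticeBall_le_of_le {n : ℕ} {m : ℝ} (hm : 1 ≤ m) (hmn : m ≤ n) :
    ((latticeBall n m).card : ℝ) ≤ 2 ^ (10 * m * Real.log (Real.exp 1 * n / m)) := by
  have hn : (0 : ℝ) < n := by linarith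
  -- For this `x` the `n`-th power is at most `exp (3xn) = exp m`, while `x ^ (-m)` contributes `m
  -- log (3n/m)`.
  set x : ℝ := m / (3 * n) with hx
  have hm0 : 0 < m := by linarith
  have hx0 : 0 < x := by positivity
  have hx3 : x ≤ 1 / 3 := by rw [hx, div_le_div_iff₀ (by positivity) (by norm_num)]; linarith
  refine (card_latticeBall_le n hm0.le hx0 (by linarith)).trans ?_
  have h1 : (1 + 2 * x / (1 - x)) ^ n ≤ Real.exp m := by
    have : 1 + 2 * x / (1 - x) ≤ Real.exp (3 * x) := by
      have h2 : 2 * x / (1 - x) ≤ 3 * x := by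
        rw [div_le_iff₀ (by linarith)]; nlinarith
      have := Real.add_one_le_exp (3 * x)
      linarith
    have h0 : 0 ≤ 2 * x / (1 - x) := div_nonneg (by linarith) (by linarith)
    calc _ ≤ Real.exp (3 * x) ^ n := by gcongr
      _ = Real.exp m := by rw [← Real.exp_nat_mul, hx]; congr 1; field_simp
  set g := Real.log (Real.exp 1 * n / m) with hg
  have hg' : g = 1 + Real.log (n / m) := by
    rw [hg, mul_div_assoc, Real.log_mul (Real.exp_pos 1).ne' (by positivity), Real.log_exp]
  have hg1 : 1 ≤ g := by
    rw [hg']; have := Real.log_nonneg ((one_le_div hm0).mpr hmn); linarith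
  have hlogx : Real.log x = 1 - g - Real.log 3 := by
    rw [hg', hx, Real.log_div hm0.ne' (by positivity), Real.log_mul (by norm_num) hn.ne',
      Real.log_div hn.ne' hm0.ne']; ring
  have hlog3 : Real.log 3 ≤ 2 := by
    have := Real.log_le_sub_one_of_pos (show (0:ℝ) < 3 by norm_num); linarith
  have hlog2 := Real.log_two_gt_d9
  calc x ^ (-m) * (1 + 2 * x / (1 - x)) ^ n ≤ x ^ (-m) * Real.exp m := by gcongr
    _ = Real.exp (m * (g + Real.log 3)) := by
      rw [Real.rpow_def_of_pos hx0, ← Real.exp_add, hlogx]; congr 1; ring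
    _ ≤ Real.exp (Real.log 2 * (10 * m * g)) := by
      refine Real.exp_le_exp.mpr ?_
      have : g + Real.log 3 ≤ Real.log 2 * 10 * g := by nlinarith
      calc m * (g + Real.log 3) ≤ m * (Real.log 2 * 10 * g) := by gcongr
        _ = _ := by ring
    _ = _ := by rw [Real.rpow_def_of_pos two_pos]

/-- Here `R = nD` with `D = 2^(4m/n)`. Taking `x = exp (-1/D)` bounds the count by `4^n (4D)^n =
2^(4n+4m)`. -/
lemma card_latticeBall_le_of_lt {n : ℕ} {m : ℝ} (hn : 1 ≤ n) (hmn : n < m) :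
    ((latticeBall n (n * 2 ^ (4 * m / n))).card : ℝ) ≤ 2 ^ (10 * m) := by
  have hn0 : (0 : ℝ) < n := by exact_mod_cast hn
  have hm0 : 0 < m := by linarith
  set D : ℝ := 2 ^ (4 * m / n) with hD
  have hD1 : 1 ≤ D := Real.one_le_rpow one_le_two (by positivity)
  have hD0 : 0 < D := by linarith
  set x : ℝ := Real.exp (-(1 / D)) with hx
  have hx0 : 0 < x := Real.exp_pos _
  have hx1 : x < 1 := Real.exp_lt_one_iff.mpr (by simpa using hD0)
  have hx' : x * (1 + 1 / D) ≤ 1 := by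
    have := Real.add_one_le_exp (1 / D)
    calc x * (1 + 1 / D) ≤ x * Real.exp (1 / D) := by gcongr; linarith
      _ = 1 := by rw [hx, ← Real.exp_add]; simp
  have hxD : x * (D + 1) ≤ D := by
    calc x * (D + 1) = x * (1 + 1 / D) * D := by field_simp
      _ ≤ 1 * D := by gcongr
      _ = D := one_mul D
  refine (card_latticeBall_le n (by positivity) hx0 hx1).trans ?_
  have h1 : 1 + 2 * x / (1 - x) ≤ 4 * D := by
    have : 2 * x / (1 - x) ≤ 2 * D := by
      rw [div_le_iff₀ (by linarith)]; linarith
    linarith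
  have h0 : 0 ≤ 2 * x / (1 - x) := div_nonneg (by linarith) (by linarith)
  have h2 : x ^ (-(n * D)) = Real.exp 1 ^ n := by
    rw [Real.rpow_def_of_pos hx0, hx, Real.log_exp, ← Real.exp_nat_mul]
    congr 1; field_simp
  have hDn : D ^ n = 2 ^ (4 * m) := by
    rw [hD, ← Real.rpow_natCast, ← Real.rpow_mul two_pos.le]; congr 1; field_simp
  have h16 : (16 : ℝ) ^ n = 2 ^ (4 * (n : ℝ)) := by
    rw [Real.rpow_mul two_pos.le, Real.rpow_natCast]; norm_num
  calc x ^ (-(n * D)) * (1 + 2 * x / (1 - x)) ^ n ≤ 4 ^ n * (4 * D) ^ n := by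
        rw [h2]; gcongr; exact exp_one_le_four
    _ = 2 ^ (4 * (n : ℝ)) * 2 ^ (4 * m) := by
        rw [mul_pow, hDn, ← h16, ← mul_assoc, ← mul_pow]; norm_num
    _ = 2 ^ (4 * n + 4 * m) := by rw [Real.rpow_add two_pos]
    _ ≤ 2 ^ (10 * m) := Real.rpow_le_rpow_of_exponent_le one_le_two (by linarith)

/-! ### Rounding onto grids in the unit ball. -/

/-- Rounding towards zero. -/
noncomputable def truncInt (y : ℝ) : ℤ := if 0 ≤ y then ⌊y⌋ else ⌈y⌉

lemma truncInt_sq_le (y : ℝ) : (truncInt y : ℝ) ^ 2 ≤ y ^ 2 := by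
  unfold truncInt
  split_ifs with h
  · have h1 := Int.floor_le y
    have h2 : (0 : ℝ) ≤ ⌊y⌋ := by exact_mod_cast Int.floor_nonneg.mpr h
    nlinarith
  · push Not at h
    have h1 := Int.le_ceil y
    have h2 : ((⌈y⌉ : ℤ) : ℝ) ≤ 0 := by exact_mod_cast Int.ceil_le.mpr (by simpa using h.le)
    nlinarith

lemma abs_truncInt_sub_le (y : ℝ) : |(truncInt y : ℝ) - y| ≤ 1 := by
  unfold truncInt
  rw [abs_le]
  split_ifs with h
  · have h1 := Int.floor_le y
    have h2 := Int.lt_floor_add_one y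
    constructor <;> linarith
  · have h1 := Int.le_ceil y
    have h2 := Int.ceil_lt_add_one y
    constructor <;> linarith

/-- The vector `k / √R`. -/
noncomputable def gridPoint {n : ℕ} (R : ℝ) (k : Fin n → ℤ) : EuclideanSpace ℝ (Fin n) :=
  WithLp.toLp 2 fun i => (√R)⁻¹ * k i

/-- Coordinatewise rounding towards zero on the grid `R^{-1/2} ℤⁿ`. -/
noncomputable def quantize {n : ℕ} (R : ℝ) (t : EuclideanSpace ℝ (Fin n)) : EuclideanSpace ℝ (Fin n) :=
  gridPoint R fun i => truncInt (√R * t i)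

/-- The points of the grid `R^{-1/2} ℤⁿ` in the unit ball. -/
noncomputable def gridBall (n : ℕ) (R : ℝ) : Finset (EuclideanSpace ℝ (Fin n)) :=
  open Classical in (latticeBall n R).image (gridPoint R)

lemma card_gridBall_le (n : ℕ) (R : ℝ) : (gridBall n R).card ≤ (latticeBall n R).card := by
  classical exact Finset.card_image_le

lemma gridBall_subset {n : ℕ} {R : ℝ} (hR : 0 < R) :
    (gridBall n R : Set (EuclideanSpace ℝ (Fin n))) ⊆ Metric.closedBall 0 1 := by
  intro t ht
  simp only [gridBall, Finset.coe_image, Set.mem_image, Finset.mem_coe, mem_latticeBall] at ht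
  obtain ⟨k, hk, rfl⟩ := ht
  rw [mem_closedBall_zero_iff, ← sq_le_one_iff₀ (norm_nonneg _), EuclideanSpace.real_norm_sq_eq]
  simp only [gridPoint, mul_pow, inv_pow, Real.sq_sqrt hR.le, ← Finset.mul_sum]
  push_cast at hk
  rw [inv_mul_le_one₀ hR]
  exact hk

/-- The reason for rounding towards zero instead of to the nearest point: no coordinate grows, which
bounds the `ℓ₂` norm of the increments. -/
lemma quantize_sq_le {n : ℕ} {R : ℝ} (hR : 0 < R) (t : EuclideanSpace ℝ (Fin n)) (i : Fin n) :
    quantize R t i ^ 2 ≤ t i ^ 2 := by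
  have h := truncInt_sq_le (√R * t i)
  have hs := Real.sq_sqrt hR.le
  simp only [quantize, gridPoint, mul_pow, inv_pow, hs] at h ⊢
  rwa [inv_mul_le_iff₀ hR]

lemma abs_quantize_sub_le {n : ℕ} {R : ℝ} (hR : 0 < R) (t : EuclideanSpace ℝ (Fin n))
    (i : Fin n) : |quantize R t i - t i| ≤ (√R)⁻¹ := by
  have hs : 0 < √R := Real.sqrt_pos.mpr hR
  have h := abs_truncInt_sub_le (√R * t i)
  have e : quantize R t i - t i = (√R)⁻¹ * ((truncInt (√R * t i) : ℝ) - √R * t i) := by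
    simp only [quantize, gridPoint]; field_simp
  rw [e, abs_mul, abs_of_pos (inv_pos.mpr hs)]
  exact mul_le_of_le_one_right (by positivity) h

lemma sum_sq_le_one {n : ℕ} {t : EuclideanSpace ℝ (Fin n)} (ht : t ∈ Metric.closedBall 0 1) :
    ∑ i, t i ^ 2 ≤ 1 := by
  rw [← EuclideanSpace.real_norm_sq_eq]
  rw [mem_closedBall_zero_iff] at ht
  nlinarith [norm_nonneg t]

lemma quantize_mem_gridBall {n : ℕ} {R : ℝ} (hR : 0 < R) {t : EuclideanSpace ℝ (Fin n)}
    (ht : t ∈ Metric.closedBall 0 1) : quantize R t ∈ gridBall n R := by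
  classical
  refine Finset.mem_image_of_mem _ (mem_latticeBall.mpr ?_)
  push_cast
  calc ∑ i, (truncInt (√R * t i) : ℝ) ^ 2 ≤ ∑ i, (√R * t i) ^ 2 :=
        Finset.sum_le_sum fun i _ => truncInt_sq_le _
    _ = R * ∑ i, t i ^ 2 := by simp [mul_pow, Real.sq_sqrt hR.le, Finset.mul_sum]
    _ ≤ R * 1 := by gcongr; exact sum_sq_le_one ht
    _ = R := mul_one R

/-! ### Hölder's inequality, the chain and its admissibility. -/

/-- A convex-combination bound for weighted sums of squares on an `ℓ_p` ball. -/
lemma sum_mul_sq_le {n : ℕ} {p κ W b : ℝ} (hp : 2 < p) (hκ : 0 < κ) (hW : 0 ≤ W) (hb : 0 ≤ b)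
    {w x : Fin n → ℝ} (hw0 : ∀ i, 0 ≤ w i) (hwb : ∀ i, w i ≤ b) (hwW : ∑ i, w i ≤ W)
    (hx : (∑ i, |x i| ^ p) ^ (1 / p) ≤ κ * (n : ℝ) ^ (1 / p)) :
    ∑ i, w i * x i ^ 2 ≤ κ ^ 2 * (W ^ (1 - 2 / p) * (b * n) ^ (2 / p)) := by
  have hp0 : 0 < p := by linarith
  -- Hölder with exponent `p/2` with respect to the weights: `∑ w x² ≤ (∑ w)^(1-2/p) (∑ w
  -- |x|^p)^(2/p)`.
  have h := Real.inner_le_weight_mul_Lp_of_nonneg Finset.univ (p := p / 2) (by linarith) w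
    (fun i => x i ^ 2) hw0 fun i => sq_nonneg _
  have hS : ∑ i, |x i| ^ p ≤ κ ^ p * n := by
    have h0 : 0 ≤ ∑ i, |x i| ^ p := Finset.sum_nonneg fun i _ => by positivity
    have := Real.rpow_le_rpow (by positivity) hx hp0.le
    rwa [← Real.rpow_mul h0, Real.mul_rpow hκ.le (by positivity), ← Real.rpow_mul (by positivity),
      one_div_mul_cancel hp0.ne', Real.rpow_one, Real.rpow_one] at this
  have hpow : ∀ i, (x i ^ 2) ^ (p / 2) = |x i| ^ p := fun i => by
    rw [← sq_abs, ← Real.rpow_natCast, ← Real.rpow_mul (abs_nonneg _)]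
    congr 1; push_cast; ring
  simp only [hpow, inv_div] at h
  refine h.trans ?_
  have h1 : ∑ i, w i * |x i| ^ p ≤ b * (κ ^ p * n) :=
    calc ∑ i, w i * |x i| ^ p ≤ ∑ i, b * |x i| ^ p := by
          gcongr with i; exact hwb i
      _ = b * ∑ i, |x i| ^ p := by rw [Finset.mul_sum]
      _ ≤ _ := by gcongr
  have hexp : 0 ≤ 1 - 2 / p := by
    rw [sub_nonneg, div_le_one hp0]; exact hp.le
  have hw : 0 ≤ ∑ i, w i := Finset.sum_nonneg fun i _ => hw0 i
  have hw' : 0 ≤ ∑ i, w i * |x i| ^ p :=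
    Finset.sum_nonneg fun i _ => mul_nonneg (hw0 i) (by positivity)
  calc _ ≤ W ^ (1 - 2 / p) * (b * (κ ^ p * n)) ^ (2 / p) := by gcongr
    _ = _ := by
      rw [show b * (κ ^ p * n) = κ ^ p * (b * n) by ring,
        Real.mul_rpow (by positivity) (by positivity), ← Real.rpow_mul hκ.le,
        mul_div_cancel₀ _ hp0.ne', Real.rpow_two]
      ring

lemma le_two_rpow {x : ℝ} (hx : 1 ≤ x) : x ≤ 2 ^ x := by
  have := one_add_mul_self_le_rpow_one_add (s := 1) (by norm_num) hx
  norm_num at this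
  linarith

lemma le_invMeshSq {n : ℕ} (hn : 1 ≤ n) {m : ℝ} : m ≤ invMeshSq n m := by
  have hn0 : (0 : ℝ) < n := by exact_mod_cast hn
  unfold invMeshSq
  split_ifs with h
  · exact le_rfl
  · push Not at h
    have h1 : 1 ≤ 4 * m / n := by rw [le_div_iff₀ hn0]; linarith
    have h2 := mul_le_mul_of_nonneg_left (le_two_rpow h1) hn0.le
    rw [mul_div_cancel₀ _ hn0.ne'] at h2
    linarith

lemma invMeshSq_mono {n : ℕ} (hn : 1 ≤ n) {m m' : ℝ} (h : m ≤ m') :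
    invMeshSq n m ≤ invMeshSq n m' := by
  by_cases h1 : m ≤ n
  · have e : invMeshSq n m = m := if_pos h1
    rw [e]; exact h.trans (le_invMeshSq hn)
  · have h2 : ¬ m' ≤ n := fun h' => h1 (h.trans h')
    simp only [invMeshSq, h1, h2, if_false]
    gcongr
    exact one_le_two

/-- The approximation maps of the chaining. -/
noncomputable def ballProj (n s₁ s : ℕ) (t : EuclideanSpace ℝ (Fin n)) :
    EuclideanSpace ℝ (Fin n) :=
  quantize (invMeshSq n (2 ^ (s + s₁))) t

/-- The nets of the chaining. -/
noncomputable def ballNet (n s₁ s : ℕ) : Finset (EuclideanSpace ℝ (Fin n)) :=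
  gridBall n (invMeshSq n (2 ^ (s + s₁)))

lemma invMeshSq_two_pow_pos {n : ℕ} (hn : 1 ≤ n) (k : ℕ) : 0 < invMeshSq n (2 ^ k) :=
  (by positivity : (0 : ℝ) < 2 ^ k).trans_le (le_invMeshSq hn)

lemma le_eta (n s₁ s : ℕ) : 10 * 2 ^ (s + s₁) ≤ eta 10 n s₁ s :=
  le_mul_of_one_le_right (by positivity) (le_max_right _ _)

lemma eta_pos (n s₁ s : ℕ) : 0 < eta 10 n s₁ s :=
  lt_of_lt_of_le (by positivity) (le_eta n s₁ s)

lemma log_exp_one_mul_div {a m : ℝ} (ha : 0 < a) (hm : 0 < m) :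
    Real.log (Real.exp 1 * a / m) = 1 + Real.log (a / m) := by
  rw [mul_div_assoc, Real.log_mul (Real.exp_pos 1).ne' (by positivity), Real.log_exp]

lemma log_eta_succ {n : ℕ} (hn : 1 ≤ n) (s₁ s : ℕ) :
    Real.log (Real.exp 1 * n / 2 ^ (s + s₁)) =
      Real.log (Real.exp 1 * n / 2 ^ (s + 1 + s₁)) + Real.log 2 := by
  have hn0 : (0 : ℝ) < n := by exact_mod_cast hn
  rw [← Real.log_mul (by positivity) (by norm_num)]
  congr 1
  rw [show s + 1 + s₁ = s + s₁ + 1 by ring, pow_succ]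
  field_simp

/-- Doubling `2^(s+s₁)` lowers the logarithm by `log 2 < 1`; as the maximum is at least `1`, it at
most halves. -/
lemma eta_le_eta_succ {n : ℕ} (hn : 1 ≤ n) (s₁ s : ℕ) :
    eta 10 n s₁ s ≤ eta 10 n s₁ (s + 1) := by
  have h2 := Real.log_two_lt_d9
  have h : max (Real.log (Real.exp 1 * n / 2 ^ (s + s₁))) 1 ≤
      2 * max (Real.log (Real.exp 1 * n / 2 ^ (s + 1 + s₁))) 1 := by
    rw [log_eta_succ hn]
    have a1 := le_max_left (Real.log (Real.exp 1 * n / 2 ^ (s + 1 + s₁))) 1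
    have a2 := le_max_right (Real.log (Real.exp 1 * n / 2 ^ (s + 1 + s₁))) 1
    exact max_le (by linarith) (by linarith)
  unfold eta
  calc _ ≤ 10 * 2 ^ (s + s₁) * (2 * max (Real.log (Real.exp 1 * n / 2 ^ (s + 1 + s₁))) 1) := by
        gcongr
    _ = _ := by rw [show s + 1 + s₁ = s + s₁ + 1 by ring, pow_succ]; ring

lemma eta_succ_le {n : ℕ} (hn : 1 ≤ n) (s₁ s : ℕ) :
    eta 10 n s₁ (s + 1) ≤ 2 * eta 10 n s₁ s := by
  have h2 := Real.log_two_gt_d9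
  have h : max (Real.log (Real.exp 1 * n / 2 ^ (s + 1 + s₁))) 1 ≤
      max (Real.log (Real.exp 1 * n / 2 ^ (s + s₁))) 1 := by
    rw [log_eta_succ hn s₁ s]
    exact max_le_max (by linarith) le_rfl
  unfold eta
  calc _ ≤ 10 * 2 ^ (s + 1 + s₁) * max (Real.log (Real.exp 1 * n / 2 ^ (s + s₁))) 1 := by
        gcongr
    _ = _ := by rw [show s + 1 + s₁ = s + s₁ + 1 by ring, pow_succ]; ring

lemma eta_mono {n : ℕ} (hn : 1 ≤ n) (s₁ : ℕ) : Monotone (eta 10 n s₁) :=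
  monotone_nat_of_le_succ (eta_le_eta_succ hn s₁)

lemma isAdmissible_ball {n : ℕ} (hn : 1 ≤ n) (s₁ : ℕ) :
    IsAdmissible (eta 10 n s₁) (Metric.closedBall 0 1) (ballNet n s₁) (ballProj n s₁) where
  subset s := gridBall_subset (invMeshSq_two_pow_pos hn _)
  card_le s := by
    refine (Nat.cast_le.mpr (card_gridBall_le n _)).trans ?_
    by_cases h : (2 : ℝ) ^ (s + s₁) ≤ n
    · simp only [invMeshSq, h, if_true]
      refine (card_latticeBall_le_of_le (one_le_pow₀ one_le_two) h).trans
        (Real.rpow_le_rpow_of_exponent_le one_le_two ?_)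
      unfold eta
      gcongr
      exact le_max_left _ _
    · simp only [invMeshSq, h, if_false]
      exact (card_latticeBall_le_of_lt hn (not_le.mp h)).trans
        (Real.rpow_le_rpow_of_exponent_le one_le_two (le_eta n s₁ s))
  maps_to s v hv := quantize_mem_gridBall (invMeshSq_two_pow_pos hn _) hv
  tendsto v _ := by
    have key : ∀ i, Tendsto (fun s => ballProj n s₁ s v i) atTop (𝓝 (v i)) := fun i => by
      have hpow : Tendsto (fun s : ℕ => (2 : ℝ) ^ (s + s₁)) atTop atTop :=
        (tendsto_pow_atTop_atTop_of_one_lt one_lt_two).comp (tendsto_add_atTop_nat s₁)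
      have hR : Tendsto (fun s : ℕ => (√(invMeshSq n (2 ^ (s + s₁))))⁻¹) atTop (𝓝 0) :=
        tendsto_inv_atTop_zero.comp (Real.tendsto_sqrt_atTop.comp
          (tendsto_atTop_mono (fun s => le_invMeshSq hn) hpow))
      rw [tendsto_iff_dist_tendsto_zero]
      exact squeeze_zero (fun _ => dist_nonneg)
        (fun s => abs_quantize_sub_le (invMeshSq_two_pow_pos hn _) v i) hR
    have h2 : Tendsto (fun s => (WithLp.toLp 2 (WithLp.ofLp (ballProj n s₁ s v)) :
        EuclideanSpace ℝ (Fin n))) atTop (𝓝 (WithLp.toLp 2 (WithLp.ofLp v))) :=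
      ((PiLp.continuous_toLp 2 _).tendsto _).comp (tendsto_pi_nhds.mpr key)
    exact h2

/-! ### Size of the increments on the support of the measure. -/

/-- The size of the functionals `⟨Δ_s t, ·⟩` on the support of the measure. -/
noncomputable def widthBound (p : ℝ) (n s₁ : ℕ) : ℕ → ℝ
  | 0 => (n : ℝ) ^ (1 / p)
  | s + 1 =>
    if 2 ^ (s + 1 + s₁) ≤ n then (n : ℝ) ^ (1 / p) * ((2 : ℝ) ^ (s + 1 + s₁)) ^ (-(1 / p))
    else (2 : ℝ) ^ (-((2 : ℝ) ^ (s + 1 + s₁) / n))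

lemma widthBound_pos {p : ℝ} {n : ℕ} (hn : 1 ≤ n) (s₁ s : ℕ) : 0 < widthBound p n s₁ s := by
  have hn0 : (0 : ℝ) < n := by exact_mod_cast hn
  cases s with
  | zero => simp only [widthBound]; positivity
  | succ s => simp only [widthBound]; split_ifs <;> positivity

lemma theta_succ (c p : ℝ) (n s₁ : ℕ) (u : ℝ) (s : ℕ) (v : EuclideanSpace ℝ (Fin n)) :
    theta c 10 p n s₁ u (s + 1) v =
      c * √u * √(eta 10 n s₁ (s + 1)) * widthBound p n s₁ (s + 1) := by
  simp only [theta, widthBound]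
  split_ifs <;> ring

lemma le_theta {c p : ℝ} (hc : 0 < c) (hp : 2 < p) (n s₁ : ℕ) (u : ℝ) (s : ℕ)
    (v : EuclideanSpace ℝ (Fin n)) :
    c * √u * √(eta 10 n s₁ s) * widthBound p n s₁ s ≤ theta c 10 p n s₁ u s v := by
  cases s with
  | zero =>
    simp only [theta, widthBound]
    refine le_mul_of_one_le_right (by positivity) ?_
    refine Real.one_le_rpow (one_le_pow₀ one_le_two) ?_
    have := one_div_le_one_div_of_le two_pos hp.le
    linarith
  | succ s => exact (theta_succ c p n s₁ u s v).ge

/-- The squared coordinates of `Δ_s t` serve as weights in `sum_mul_sq_le`. Their maximum comes from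
the mesh at level `s-1`; their total comes from `‖t‖ ≤ 1` while `2^(s+s₁) ≤ n`, and from `n` times
the maximum afterwards. In the latter case the two powers combine to exponent `1` and `p`
disappears. -/
lemma sum_increment_sq_le {n : ℕ} (hn : 1 ≤ n) {p κ : ℝ} (hp : 2 < p) (hκ : 0 < κ) (s₁ s : ℕ)
    {t x : EuclideanSpace ℝ (Fin n)} (ht : t ∈ Metric.closedBall 0 1)
    (hx : (∑ i, |x i| ^ p) ^ (1 / p) ≤ κ * (n : ℝ) ^ (1 / p)) :
    ∑ i, increment (ballProj n s₁) s t i ^ 2 * x i ^ 2 ≤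
      128 * κ ^ 2 * widthBound p n s₁ s ^ 2 := by
  have hn0 : (0 : ℝ) < n := by exact_mod_cast hn
  have hp0 : 0 < p := by linarith
  have ht1 := sum_sq_le_one ht
  have htw : ∀ i, t i ^ 2 ≤ 1 := fun i =>
    (Finset.single_le_sum (f := fun i => t i ^ 2) (fun i _ => sq_nonneg _)
      (Finset.mem_univ i)).trans ht1
  have hproj : ∀ s i, ballProj n s₁ s t i ^ 2 ≤ t i ^ 2 := fun s i =>
    quantize_sq_le (invMeshSq_two_pow_pos hn _) t i
  have h2p : 2 / p ≤ 1 := (div_le_one hp0).mpr hp.le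
  cases s with
  | zero =>
    have h := sum_mul_sq_le hp hκ zero_le_one zero_le_one
      (w := fun i => increment (ballProj n s₁) 0 t i ^ 2) (x := fun i => x i)
      (fun i => sq_nonneg _) (fun i => (hproj 0 i).trans (htw i))
      ((Finset.sum_le_sum fun i _ => hproj 0 i).trans ht1) hx
    refine h.trans ?_
    simp only [widthBound]
    rw [Real.one_rpow, one_mul, one_mul, ← Real.rpow_natCast ((n : ℝ) ^ (1 / p)),
      ← Real.rpow_mul hn0.le, show 1 / p * ((2 : ℕ) : ℝ) = 2 / p by push_cast; ring]
    have : 0 ≤ κ ^ 2 * (n : ℝ) ^ (2 / p) := by positivity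
    nlinarith
  | succ s =>
    set m' : ℝ := 2 ^ (s + s₁) with hm'
    have hm'0 : 0 < m' := by positivity
    have hm : (2 : ℝ) ^ (s + 1 + s₁) = 2 * m' := by
      rw [hm', show s + 1 + s₁ = s + s₁ + 1 by ring, pow_succ]; ring
    set R := invMeshSq n m' with hR
    have hR0 : 0 < R := invMeshSq_two_pow_pos hn _
    have hRle : R ≤ invMeshSq n (2 ^ (s + 1 + s₁)) := by
      rw [hm]; exact invMeshSq_mono hn (by linarith)
    have hinc : ∀ i, increment (ballProj n s₁) (s + 1) t i =
        ballProj n s₁ (s + 1) t i - ballProj n s₁ s t i := fun i => rfl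
    have hb : ∀ i, increment (ballProj n s₁) (s + 1) t i ^ 2 ≤ 4 / R := fun i => by
      have h1 := abs_quantize_sub_le (invMeshSq_two_pow_pos hn (s + 1 + s₁)) t i
      have h2 := abs_quantize_sub_le hR0 t i
      have h3 : (√(invMeshSq n (2 ^ (s + 1 + s₁))))⁻¹ ≤ (√R)⁻¹ := by
        gcongr
      have h4 : |increment (ballProj n s₁) (s + 1) t i| ≤ 2 * (√R)⁻¹ := by
        rw [hinc]
        have := abs_sub_le (ballProj n s₁ (s + 1) t i) (t i) (ballProj n s₁ s t i)
        rw [abs_sub_comm (t i)] at this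
        unfold ballProj at this ⊢
        linarith
      calc increment (ballProj n s₁) (s + 1) t i ^ 2
          = |increment (ballProj n s₁) (s + 1) t i| ^ 2 := (sq_abs _).symm
        _ ≤ (2 * (√R)⁻¹) ^ 2 := by gcongr
        _ = 4 / R := by rw [mul_pow, inv_pow, Real.sq_sqrt hR0.le]; ring
    have hb0 : 0 ≤ 4 / R := by positivity
    by_cases hmn : 2 ^ (s + 1 + s₁) ≤ n
    · have hmn' : 2 * m' ≤ n := by rw [← hm]; exact_mod_cast hmn
      have hRm : R = m' := by simp only [hR, invMeshSq]; rw [if_pos (by linarith)]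
      have hW : ∑ i, increment (ballProj n s₁) (s + 1) t i ^ 2 ≤ 4 := by
        calc _ ≤ ∑ i, 4 * t i ^ 2 := by
              refine Finset.sum_le_sum fun i _ => ?_
              rw [hinc]
              have h1 := hproj (s + 1) i
              have h2 := hproj s i
              nlinarith [sq_nonneg (ballProj n s₁ (s + 1) t i + ballProj n s₁ s t i)]
          _ = 4 * ∑ i, t i ^ 2 := by rw [Finset.mul_sum]
          _ ≤ 4 := by linarith
      have h := sum_mul_sq_le hp hκ (by norm_num : (0 : ℝ) ≤ 4) hb0
        (w := fun i => increment (ballProj n s₁) (s + 1) t i ^ 2) (x := fun i => x i)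
        (fun i => sq_nonneg _) hb hW hx
      refine h.trans ?_
      have e1 : (4 / R * n : ℝ) = 4 * 2 * (n / (2 * m')) := by rw [hRm]; field_simp
      have e2 : widthBound p n s₁ (s + 1) ^ 2 = (n / (2 * m')) ^ (2 / p) := by
        simp only [widthBound, if_pos hmn, hm]
        rw [Real.rpow_neg (by positivity), ← div_eq_mul_inv, ← Real.div_rpow hn0.le (by positivity),
          ← Real.rpow_natCast, ← Real.rpow_mul (by positivity)]
        congr 1; push_cast; ring
      have e3 : (4 : ℝ) ^ (1 - 2 / p) * 4 ^ (2 / p) = 4 := by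
        rw [← Real.rpow_add (by norm_num)]; simp
      have e4 : (2 : ℝ) ^ (2 / p) ≤ 2 := by
        simpa using Real.rpow_le_rpow_of_exponent_le one_le_two h2p
      rw [e1, e2, Real.mul_rpow (by norm_num) (by positivity),
        Real.mul_rpow (by norm_num) (by norm_num)]
      set Z := ((n : ℝ) / (2 * m')) ^ (2 / p) with hZ
      have hZ0 : 0 ≤ Z := by positivity
      calc κ ^ 2 * (4 ^ (1 - 2 / p) * (4 ^ (2 / p) * 2 ^ (2 / p) * Z))
          = (4 ^ (1 - 2 / p) * 4 ^ (2 / p)) * 2 ^ (2 / p) * (κ ^ 2 * Z) := by ring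
        _ ≤ 4 * 2 * (κ ^ 2 * Z) := by rw [e3]; gcongr
        _ ≤ 128 * κ ^ 2 * Z := by have : 0 ≤ κ ^ 2 * Z := by positivity
                                  linarith
    · have hmn' : (n : ℝ) < 2 * m' := by rw [← hm]; exact_mod_cast not_le.mp hmn
      have hW : ∑ i, increment (ballProj n s₁) (s + 1) t i ^ 2 ≤ 4 / R * n := by
        calc _ ≤ ∑ i : Fin n, 4 / R := Finset.sum_le_sum fun i _ => hb i
          _ = 4 / R * n := by simp [mul_comm]
      have h := sum_mul_sq_le hp hκ (by positivity : (0 : ℝ) ≤ 4 / R * n) hb0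
        (w := fun i => increment (ballProj n s₁) (s + 1) t i ^ 2) (x := fun i => x i)
        (fun i => sq_nonneg _) hb hW hx
      rw [← Real.rpow_add (by positivity), sub_add_cancel, Real.rpow_one] at h
      refine h.trans ?_
      rw [mul_comm (128 : ℝ), mul_assoc]
      refine mul_le_mul_of_nonneg_left ?_ (sq_nonneg κ)
      have e2 : widthBound p n s₁ (s + 1) ^ 2 = 2 ^ (-(4 * m' / n)) := by
        simp only [widthBound, if_neg hmn, hm]
        rw [← Real.rpow_natCast, ← Real.rpow_mul (by positivity)]
        congr 1; push_cast; ring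
      rw [e2]
      -- In the transition `m' ≤ n < 2m'` the previous mesh is still the coarse one, and `8 = 128 /
      -- 16` fixes the constant `128`. Later on, the exponent `4` in `invMeshSq` reproduces the
      -- decay of `widthBound` squared exactly.
      by_cases h1 : m' ≤ n
      · have hRm : R = m' := by simp only [hR, invMeshSq]; rw [if_pos h1]
        have h3 : (2 : ℝ) ^ (-4 : ℝ) ≤ 2 ^ (-(4 * m' / n)) := by
          refine Real.rpow_le_rpow_of_exponent_le one_le_two (neg_le_neg ?_)
          rw [div_le_iff₀ hn0]; linarith
        have h4 : (2 : ℝ) ^ (-4 : ℝ) = 1 / 16 := by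
          rw [Real.rpow_neg two_pos.le]; norm_num
        have h5 : 4 / R * n ≤ 8 := by
          rw [hRm, div_mul_eq_mul_div, div_le_iff₀ hm'0]; linarith
        linarith
      · have hRm : R = n * 2 ^ (4 * m' / n) := by simp only [hR, invMeshSq]; rw [if_neg h1]
        have : 4 / R * n = 4 * 2 ^ (-(4 * m' / n)) := by
          rw [hRm, Real.rpow_neg two_pos.le]; field_simp
        rw [this]
        have : (0 : ℝ) < 2 ^ (-(4 * m' / n)) := by positivity
        linarith

/-! ### Summation of the functionals `θ`. -/

lemma sqrt_rpow {x : ℝ} (hx : 0 ≤ x) (a : ℝ) : √(x ^ a) = x ^ (a / 2) := by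
  rw [Real.sqrt_eq_rpow, ← Real.rpow_mul hx]; congr 1; ring

lemma one_add_log_le {z a : ℝ} (hz : 1 ≤ z) (ha : 0 < a) :
    1 + Real.log z ≤ (1 + 1 / a) * z ^ a := by
  have h1 := Real.log_le_rpow_div (by linarith : 0 ≤ z) ha
  have h2 := Real.one_le_rpow hz ha.le
  calc 1 + Real.log z ≤ z ^ a + z ^ a / a := add_le_add h2 h1
    _ = _ := by ring

/-- For `m ≤ n` the term without its logarithm is about `√n (m/n)^a`; half of the exponent `a` is
spent on absorbing the logarithm. For `m > n` the factor `2^(-m/n)` beats any power. -/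
lemma sqrt_eta_mul_widthBound_le {p a : ℝ} (hp : 2 < p) (ha : a = 1 / 2 - 1 / p) {n : ℕ}
    (hn : 1 ≤ n) (s₁ s : ℕ) :
    √(eta 10 n s₁ (s + 1)) * widthBound p n s₁ (s + 1) ≤
      √(10 * (1 + 1 / a)) * √n * min (((2 : ℝ) ^ (s + 1 + s₁) / n) ^ (a / 2))
        (((2 : ℝ) ^ (s + 1 + s₁) / n) ^ (a / 2))⁻¹ := by
  have hn0 : (0 : ℝ) < n := by exact_mod_cast hn
  have hp0 : 0 < p := by linarith
  have ha0 : 0 < a := by rw [ha, sub_pos]; exact one_div_lt_one_div_of_lt two_pos hp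
  have ha1 : a < 1 / 2 := by rw [ha]; linarith [one_div_pos.mpr hp0]
  set m : ℝ := 2 ^ (s + 1 + s₁) with hm
  have hm0 : 0 < m := by positivity
  set K : ℝ := 1 + 1 / a with hK
  have hK1 : 1 ≤ K := by have := one_div_pos.mpr ha0; linarith
  by_cases h : 2 ^ (s + 1 + s₁) ≤ n
  · have hmn : m ≤ n := by rw [hm]; exact_mod_cast h
    set z : ℝ := n / m with hz
    have hz1 : 1 ≤ z := (one_le_div hm0).mpr hmn
    have hz0 : 0 < z := by linarith
    have hx : m / n = z⁻¹ := by rw [hz, inv_div]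
    have hw : widthBound p n s₁ (s + 1) = z ^ (1 / p) := by
      simp only [widthBound, if_pos h]
      rw [← hm, Real.rpow_neg hm0.le, ← div_eq_mul_inv, ← Real.div_rpow hn0.le hm0.le]
    have he : eta 10 n s₁ (s + 1) ≤ 10 * K * (n * z ^ (a - 1)) := by
      have h1 : eta 10 n s₁ (s + 1) = 10 * m * (1 + Real.log z) := by
        rw [eta, ← hm, log_exp_one_mul_div hn0 hm0, max_eq_left]
        have := Real.log_nonneg hz1
        linarith
      have h2 : (n : ℝ) * z ^ (a - 1) = m * z ^ a := by
        rw [Real.rpow_sub hz0, Real.rpow_one, hz]; field_simp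
      rw [h1, h2]
      calc 10 * m * (1 + Real.log z) ≤ 10 * m * (K * z ^ a) := by
            gcongr; exact one_add_log_le hz1 ha0
        _ = _ := by ring
    have hy : (m / n) ^ (a / 2) = z ^ (-(a / 2)) := by
      rw [hx, Real.inv_rpow hz0.le, Real.rpow_neg hz0.le]
    have hy1 : (m / n) ^ (a / 2) ≤ 1 :=
      Real.rpow_le_one (by positivity) ((div_le_one hn0).mpr hmn) (by linarith)
    have hy0 : 0 < (m / n) ^ (a / 2) := by positivity
    rw [min_eq_left (hy1.trans ((one_le_inv₀ hy0).mpr hy1)), hw, hy]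
    calc √(eta 10 n s₁ (s + 1)) * z ^ (1 / p)
        ≤ √(10 * K * (n * z ^ (a - 1))) * z ^ (1 / p) := by gcongr
      _ = √(10 * K) * √n * (z ^ ((a - 1) / 2) * z ^ (1 / p)) := by
          rw [Real.sqrt_mul (by positivity), Real.sqrt_mul hn0.le, sqrt_rpow hz0.le]; ring
      _ = _ := by
          rw [← Real.rpow_add hz0]; congr 2; rw [ha]; ring
  · have hmn : (n : ℝ) < m := by rw [hm]; exact_mod_cast not_le.mp h
    set x : ℝ := m / n with hx
    have hx1 : 1 ≤ x := (one_le_div hn0).mpr hmn.le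
    have hx0 : 0 < x := by linarith
    have hw : widthBound p n s₁ (s + 1) = 2 ^ (-x) := by
      simp only [widthBound, if_neg h]; rfl
    have he : eta 10 n s₁ (s + 1) = 10 * (n * x) := by
      rw [eta, ← hm, log_exp_one_mul_div hn0 hm0, max_eq_right, hx]
      · field_simp
      · have := Real.log_nonpos (by positivity) ((div_le_one hm0).mpr hmn.le)
        linarith
    have hy1 : 1 ≤ x ^ (a / 2) := Real.one_le_rpow hx1 (by linarith)
    have hy0 : 0 < x ^ (a / 2) := by positivity
    rw [min_eq_right ((inv_le_one₀ hy0).mpr hy1 |>.trans hy1), hw, he]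
    have key : √x * 2 ^ (-x) ≤ (x ^ (a / 2))⁻¹ := by
      rw [Real.rpow_neg two_pos.le, ← div_eq_mul_inv, ← one_div,
        div_le_div_iff₀ (by positivity) hy0, one_mul, Real.sqrt_eq_rpow, ← Real.rpow_add hx0]
      calc x ^ (1 / 2 + a / 2) ≤ x ^ (1 : ℝ) :=
            Real.rpow_le_rpow_of_exponent_le hx1 (by linarith)
        _ = x := Real.rpow_one x
        _ ≤ 2 ^ x := le_two_rpow hx1
    calc √(10 * (n * x)) * 2 ^ (-x) = √10 * √n * (√x * 2 ^ (-x)) := by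
          rw [Real.sqrt_mul (by norm_num), Real.sqrt_mul hn0.le]; ring
      _ ≤ √(10 * K) * √n * (x ^ (a / 2))⁻¹ := by
          gcongr
          linarith

/-- Along a geometric sequence of ratio `q`, `min y y⁻¹` is dominated by increments of the bounded
function `y / (1 + y)`. Summing therefore needs no split at `m = n`. -/
lemma min_inv_le_telescope {y q : ℝ} (hy : 0 < y) (hq : 1 < q) :
    min y y⁻¹ ≤ 2 * (q + 1) / (q - 1) * (q * y / (1 + q * y) - y / (1 + y)) := by
  have hq1 : 0 < q - 1 := by linarith
  have e : 2 * (q + 1) / (q - 1) * (q * y / (1 + q * y) - y / (1 + y)) =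
      2 * (q + 1) * y / ((1 + q * y) * (1 + y)) := by
    field_simp
    ring
  rw [e]
  rcases le_total y 1 with h | h
  · refine (min_le_left _ _).trans ?_
    rw [le_div_iff₀ (by positivity)]
    have h1 : (1 + q * y) * (1 + y) ≤ (q + 1) * 2 := by
      have : q * y ≤ q := by nlinarith
      exact mul_le_mul (by linarith) (by linarith) (by linarith) (by linarith)
    nlinarith
  · refine (min_le_right _ _).trans ?_
    rw [inv_eq_one_div, div_le_div_iff₀ hy (by positivity)]
    have : (1 + q * y) * (1 + y) ≤ ((q + 1) * y) * (2 * y) :=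
      mul_le_mul (by linarith) (by linarith) (by linarith) (by positivity)
    linarith

lemma sum_sqrt_eta_mul_widthBound_le {p : ℝ} (hp : 2 < p) :
    ∃ C : ℝ, 0 < C ∧ ∀ n s₁ : ℕ, 1 ≤ n → ∀ S : ℕ,
      ∑ s ∈ Finset.range S, √(eta 10 n s₁ (s + 1)) * widthBound p n s₁ (s + 1) ≤ C * √n := by
  obtain ⟨a, ha⟩ : ∃ a : ℝ, a = 1 / 2 - 1 / p := ⟨_, rfl⟩
  have ha0 : 0 < a := by rw [ha, sub_pos]; exact one_div_lt_one_div_of_lt two_pos hp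
  set q : ℝ := 2 ^ (a / 2) with hq
  have hq1 : 1 < q := Real.one_lt_rpow one_lt_two (by linarith)
  have hD : 0 < 2 * (q + 1) / (q - 1) := div_pos (by linarith) (by linarith)
  refine ⟨√(10 * (1 + 1 / a)) * (2 * (q + 1) / (q - 1)), mul_pos (by positivity) hD, ?_⟩
  intro n s₁ hn S
  have hn0 : (0 : ℝ) < n := by exact_mod_cast hn
  set y : ℕ → ℝ := fun s => ((2 : ℝ) ^ (s + 1 + s₁) / n) ^ (a / 2) with hy
  have hy0 : ∀ s, 0 < y s := fun s => by simp only [hy]; positivity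
  have hys : ∀ s, y (s + 1) = q * y s := fun s => by
    simp only [hy, hq]
    rw [← Real.mul_rpow two_pos.le (by positivity)]
    congr 1
    rw [show s + 1 + 1 + s₁ = s + 1 + s₁ + 1 by ring, pow_succ]; ring
  calc ∑ s ∈ Finset.range S, √(eta 10 n s₁ (s + 1)) * widthBound p n s₁ (s + 1)
      ≤ ∑ s ∈ Finset.range S, √(10 * (1 + 1 / a)) * √n * (2 * (q + 1) / (q - 1) *
          (y (s + 1) / (1 + y (s + 1)) - y s / (1 + y s))) := by
        refine Finset.sum_le_sum fun s _ => ?_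
        refine (sqrt_eta_mul_widthBound_le hp ha hn s₁ s).trans ?_
        rw [hys]
        exact mul_le_mul_of_nonneg_left (min_inv_le_telescope (hy0 s) hq1) (by positivity)
    _ = √(10 * (1 + 1 / a)) * √n * (2 * (q + 1) / (q - 1)) *
          (y S / (1 + y S) - y 0 / (1 + y 0)) := by
        rw [← Finset.sum_range_sub (fun s => y s / (1 + y s)), Finset.mul_sum]
        exact Finset.sum_congr rfl fun _ _ => by ring
    _ ≤ √(10 * (1 + 1 / a)) * √n * (2 * (q + 1) / (q - 1)) * 1 := by
        refine mul_le_mul_of_nonneg_left ?_ (mul_nonneg (by positivity) hD.le)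
        have h1 : y S / (1 + y S) ≤ 1 := by
          have := hy0 S
          rw [div_le_one (by positivity)]; linarith
        have h2 : 0 ≤ y 0 / (1 + y 0) := by have := hy0 0; positivity
        linarith
    _ = _ := by ring

/-- With `m = 2^(s₁)` of order at most `n^δ`, the term is about `n^(1/p) m^(1-1/p)` times the root
of a logarithm. The hypothesis on `δ` says precisely that `1/p + δ(1-1/p) < 1/2`; the slack `g` pays
for the logarithm through `log n ≲ n^(2g)`. -/
lemma sqrt_eta_zero_mul_le {p δ : ℝ} (hp : 2 < p) (hδ : δ < 1 / 2 - 1 / (2 * (p - 1))) :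
    ∃ C : ℝ, 0 < C ∧ ∀ n s₁ : ℕ, 1 ≤ n → (2 : ℝ) ^ s₁ ≤ 2 * (n : ℝ) ^ δ →
      √(eta 10 n s₁ 0) * (n : ℝ) ^ (1 / p) * ((2 : ℝ) ^ s₁) ^ (1 / 2 - 1 / p) ≤ C * √n := by
  have hp0 : 0 < p := by linarith
  have hp1 : 0 < p - 1 := by linarith
  obtain ⟨g, hg⟩ : ∃ g : ℝ, g = 1 / 2 - 1 / p - δ * (1 - 1 / p) := ⟨_, rfl⟩
  have hip : 1 / p < 1 / 2 := one_div_lt_one_div_of_lt two_pos hp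
  have hg0 : 0 < g := by
    have h1 : (1 / 2 - 1 / (2 * (p - 1))) * (1 - 1 / p) = 1 / 2 - 1 / p := by
      field_simp; ring
    have h2 : δ * (1 - 1 / p) < (1 / 2 - 1 / (2 * (p - 1))) * (1 - 1 / p) :=
      mul_lt_mul_of_pos_right hδ (by linarith)
    rw [hg]; linarith
  set K : ℝ := 1 + 1 / (2 * g) with hK
  have hK0 : 0 < K := by positivity
  refine ⟨√(10 * K) * 2, by positivity, fun n s₁ hn hs => ?_⟩
  have hn1 : (1 : ℝ) ≤ n := by exact_mod_cast hn
  have hn0 : (0 : ℝ) < n := by linarith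
  set m : ℝ := 2 ^ s₁ with hm
  have hm1 : 1 ≤ m := one_le_pow₀ one_le_two
  have hm0 : 0 < m := by linarith
  have he : eta 10 n s₁ 0 ≤ 10 * K * (m * n ^ (2 * g)) := by
    have h1 : max (Real.log (Real.exp 1 * n / 2 ^ (0 + s₁))) 1 ≤ 1 + Real.log n := by
      rw [zero_add, ← hm, log_exp_one_mul_div hn0 hm0, Real.log_div hn0.ne' hm0.ne']
      have := Real.log_nonneg hm1
      have := Real.log_nonneg hn1
      exact max_le (by linarith) (by linarith)
    have h2 := one_add_log_le hn1 (by linarith : 0 < 2 * g)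
    unfold eta
    calc _ ≤ 10 * 2 ^ (0 + s₁) * (K * n ^ (2 * g)) := by gcongr; exact h1.trans h2
      _ = _ := by rw [zero_add, ← hm]; ring
  have hmp : m ^ (1 - 1 / p) ≤ 2 * n ^ (δ * (1 - 1 / p)) := by
    calc m ^ (1 - 1 / p) ≤ (2 * n ^ δ) ^ (1 - 1 / p) := by
          refine Real.rpow_le_rpow hm0.le hs (by linarith)
      _ = 2 ^ (1 - 1 / p) * n ^ (δ * (1 - 1 / p)) := by
          rw [Real.mul_rpow two_pos.le (by positivity), ← Real.rpow_mul hn0.le]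
      _ ≤ 2 * n ^ (δ * (1 - 1 / p)) := by
          gcongr
          have : (2 : ℝ) ^ (1 - 1 / p) ≤ 2 ^ (1 : ℝ) :=
            Real.rpow_le_rpow_of_exponent_le one_le_two (by
              have := one_div_pos.mpr hp0; linarith)
          simpa using this
  calc √(eta 10 n s₁ 0) * (n : ℝ) ^ (1 / p) * m ^ (1 / 2 - 1 / p)
      ≤ √(10 * K * (m * n ^ (2 * g))) * (n : ℝ) ^ (1 / p) * m ^ (1 / 2 - 1 / p) := by gcongr
    _ = √(10 * K) * (n ^ (g + 1 / p) * m ^ (1 - 1 / p)) := by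
        rw [Real.sqrt_mul (by positivity), Real.sqrt_mul hm0.le, sqrt_rpow hn0.le,
          Real.rpow_add hn0, show 1 - 1 / p = 1 / 2 + (1 / 2 - 1 / p) by ring,
          Real.rpow_add hm0, Real.sqrt_eq_rpow m, show 2 * g / 2 = g by ring]
        ring
    _ ≤ √(10 * K) * (n ^ (g + 1 / p) * (2 * n ^ (δ * (1 - 1 / p)))) := by gcongr
    _ = √(10 * K) * 2 * n ^ (g + 1 / p + δ * (1 - 1 / p)) := by
        rw [Real.rpow_add hn0 (g + 1 / p)]; ring
    _ = _ := by rw [Real.sqrt_eq_rpow (n : ℝ)]; congr 2; rw [hg]; ring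

/-- The chaining functional of the ball is at most of order `√n`. -/
lemma tsum_theta_le {c p δ : ℝ} (hc : 0 < c) (hp : 2 < p)
    (hδ : δ < 1 / 2 - 1 / (2 * (p - 1))) :
    ∃ C : ℝ, 0 < C ∧ ∀ n s₁ : ℕ, 1 ≤ n → (2 : ℝ) ^ s₁ ≤ 2 * (n : ℝ) ^ δ →
      ∀ (u : ℝ) (v : ℕ → EuclideanSpace ℝ (Fin n)),
        Summable (fun s => theta c 10 p n s₁ u s (v s)) ∧
          ∑' s, theta c 10 p n s₁ u s (v s) ≤ C * √u * √(n : ℝ) := by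
  obtain ⟨C₀, hC₀, h0⟩ := sqrt_eta_zero_mul_le hp hδ
  obtain ⟨C₁, hC₁, h1⟩ := sum_sqrt_eta_mul_widthBound_le hp
  refine ⟨c * (C₀ + C₁), by positivity, fun n s₁ hn hs u v => ?_⟩
  have hpos : ∀ s, 0 ≤ theta c 10 p n s₁ u s (v s) := fun s =>
    le_trans (mul_nonneg (by positivity) (widthBound_pos hn s₁ s).le) (le_theta hc hp n s₁ u s _)
  have hsum : ∀ S, ∑ s ∈ Finset.range S, theta c 10 p n s₁ u s (v s) ≤
      c * (C₀ + C₁) * √u * √(n : ℝ) := by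
    intro S
    calc _ ≤ ∑ s ∈ Finset.range (S + 1), theta c 10 p n s₁ u s (v s) :=
          Finset.sum_le_sum_of_subset_of_nonneg (Finset.range_mono (Nat.le_succ S))
            fun s _ _ => hpos s
      _ = c * √u * (∑ s ∈ Finset.range S,
            √(eta 10 n s₁ (s + 1)) * widthBound p n s₁ (s + 1)) +
          c * √u * (√(eta 10 n s₁ 0) * (n : ℝ) ^ (1 / p) * ((2 : ℝ) ^ s₁) ^ (1 / 2 - 1 / p)) := by
          rw [Finset.sum_range_succ', Finset.mul_sum]
          congr 1
          · exact Finset.sum_congr rfl fun s _ => by rw [theta_succ]; ring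
          · simp only [theta]; ring
      _ ≤ c * √u * (C₁ * √n) + c * √u * (C₀ * √n) := by
          exact add_le_add (mul_le_mul_of_nonneg_left (h1 n s₁ hn S) (by positivity))
            (mul_le_mul_of_nonneg_left (h0 n s₁ hn hs) (by positivity))
      _ = _ := by ring
  exact ⟨summable_of_sum_range_le hpos hsum, Real.tsum_le_of_sum_range_le hpos hsum⟩

/-! ### Reduction of the event to sums over sets of sample points. -/

lemma exists_finset_sumLargest_eq {N : ℕ} (a : Fin N → ℝ) {r : ℝ} (hr : 0 ≤ r) :
    ∃ J : Finset (Fin N), (J.card : ℝ) ≤ r ∧ sumLargest a r = ∑ j ∈ J, |a j| := by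
  classical
  set e : Equiv.Perm (Fin N) := Fin.revPerm.trans (Tuple.sort fun j => |a j|) with he
  refine ⟨(Finset.univ.filter fun i : Fin N => (i.val : ℝ) + 1 ≤ r).map e.toEmbedding, ?_, ?_⟩
  · rw [Finset.card_map]
    have h : ((Finset.univ.filter fun i : Fin N => (i.val : ℝ) + 1 ≤ r).card) ≤ ⌊r⌋₊ := by
      rw [← Finset.card_map Fin.valEmbedding]
      conv_rhs => rw [← Finset.card_range ⌊r⌋₊]
      refine Finset.card_le_card fun k hk => ?_
      simp only [Finset.mem_map, Finset.mem_filter, Finset.mem_univ, true_and,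
        Fin.valEmbedding_apply] at hk
      obtain ⟨i, hi, rfl⟩ := hk
      exact Finset.mem_range.mpr (Nat.lt_of_succ_le (Nat.le_floor (by push_cast; exact hi)))
    exact (Nat.cast_le.mpr h).trans (Nat.floor_le hr)
  · rw [Finset.sum_map]
    rfl

lemma sqrt_sumLargest_sq_le {N : ℕ} {a : Fin N → ℝ} {r b : ℝ} (hr : 0 ≤ r) (hb : 0 ≤ b)
    (h : ∀ J : Finset (Fin N), (J.card : ℝ) ≤ min r N → ∑ j ∈ J, a j ^ 2 ≤ b ^ 2) :
    √(sumLargest (fun i => a i ^ 2) r) ≤ b := by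
  obtain ⟨J, hJ, e⟩ := exists_finset_sumLargest_eq (fun i => a i ^ 2) hr
  rw [Real.sqrt_le_left hb, e]
  simp only [abs_sq]
  refine h J (le_min hJ ?_)
  exact_mod_cast (Finset.card_le_univ J).trans_eq (Fintype.card_fin N)

lemma levelSize_spec {N : ℕ} (hN : 1 ≤ N) {η : ℕ → ℝ} {s : ℕ}
    (h : Real.log (Real.exp 1 * N) ≤ η s) :
    1 ≤ levelSize N η s ∧ levelSize N η s ≤ N ∧
      (levelSize N η s : ℝ) * Real.log (Real.exp 1 * N / levelSize N η s) ≤ η s := by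
  unfold levelSize
  split_ifs with h1
  · exact ⟨le_rfl, hN, by simpa using h⟩
  -- The hypothesis makes `l = 1` eligible; the `sup` of an empty set would be `0`.
  · have hne : ((Finset.Icc 1 N).filter
        (fun l : ℕ => (l : ℝ) * Real.log (Real.exp 1 * N / l) ≤ η s)).Nonempty :=
      ⟨1, by simpa using ⟨hN, h⟩⟩
    obtain ⟨l, hl, e⟩ := Finset.exists_mem_eq_sup _ hne id
    rw [e]
    simp only [Finset.mem_filter, Finset.mem_Icc, id] at hl ⊢
    exact ⟨hl.1.1, hl.1.2, hl.2⟩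

/-- The number of coordinates controlled at level `s`. -/
noncomputable def coordCount (N : ℕ) (η : ℕ → ℝ) (u : ℝ) (s : ℕ) : ℝ :=
  if η s ≤ N then min (u * levelSize N η (s + 1)) N else N

/-- Enlarging the set from `ℓ` to at most `uℓ` points multiplies the entropy by at most `u`, since
the logarithm only decreases. The factor `2` comes from the shift to level `s + 1`. When `η s > N`,
all `N` points cost only `N log e = N`. -/
lemma coordCount_spec {N : ℕ} (hN : 1 ≤ N) {η : ℕ → ℝ} {u : ℝ} (hu : 1 ≤ u) {s : ℕ}
    (hη : 0 < η s) (h2 : η (s + 1) ≤ 2 * η s) (h : Real.log (Real.exp 1 * N) ≤ η (s + 1)) :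
    0 < coordCount N η u s ∧ coordCount N η u s ≤ N ∧
      coordCount N η u s * Real.log (Real.exp 1 * N / coordCount N η u s) ≤ 2 * u * η s := by
  have hN0 : (0 : ℝ) < N := by exact_mod_cast hN
  obtain ⟨l1, lN, hl⟩ := levelSize_spec hN h
  unfold coordCount
  split_ifs with hs
  · set l : ℝ := (levelSize N η (s + 1) : ℝ)
    have l1' : 1 ≤ l := Nat.one_le_cast.mpr l1
    have lN' : l ≤ N := Nat.cast_le.mpr lN
    have hl0 : 0 < l := by linarith
    have hle : l ≤ min (u * l) N := le_min (by nlinarith) lN'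
    have hr0 : 0 < min (u * l) N := hl0.trans_le hle
    refine ⟨hr0, min_le_right _ _, ?_⟩
    have hlog : 0 ≤ Real.log (Real.exp 1 * N / min (u * l) N) := by
      rw [log_exp_one_mul_div hN0 hr0]
      have := Real.log_nonneg ((one_le_div hr0).mpr (min_le_right (u * l) (N : ℝ)))
      linarith
    calc min (u * l) N * Real.log (Real.exp 1 * N / min (u * l) N)
        ≤ u * l * Real.log (Real.exp 1 * N / min (u * l) N) := by
          gcongr; exact min_le_left _ _
      _ ≤ u * l * Real.log (Real.exp 1 * N / l) := by gcongr
      _ = u * (l * Real.log (Real.exp 1 * N / l)) := by ring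
      _ ≤ u * (2 * η s) := mul_le_mul_of_nonneg_left (hl.trans h2) (by linarith)
      _ = _ := by ring
  · refine ⟨hN0, le_rfl, ?_⟩
    rw [log_exp_one_mul_div hN0 hN0, div_self hN0.ne', Real.log_one]
    push Not at hs
    nlinarith

/-- Since `log (eN) ≤ η 0`, the first level is `0` and `π_0 t = Δ_0 t`; the third condition is then
the level-`0` case of the estimate for increments. -/
lemma mem_eventOne_of_forall {n N : ℕ} {η : ℕ → ℝ}
    {V : Set (EuclideanSpace ℝ (Fin n))}
    {π : ℕ → EuclideanSpace ℝ (Fin n) → EuclideanSpace ℝ (Fin n)}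
    {θ : ℕ → EuclideanSpace ℝ (Fin n) → ℝ} {u : ℝ} (hu : 1 ≤ u)
    (h0 : Real.log (Real.exp 1 * N) ≤ η 0) {b : ℕ → ℝ} (hb : ∀ s, 0 ≤ b s)
    (hbθ : ∀ s v, b s ≤ θ s v) {X : Fin N → EuclideanSpace ℝ (Fin n)}
    (hX : ∀ t ∈ V, ∀ s, ∀ J : Finset (Fin N), (J.card : ℝ) ≤ coordCount N η u s →
      ∑ j ∈ J, (inner ℝ (increment π s t) (X j)) ^ 2 ≤ b s ^ 2) :
    X ∈ eventOne N η V π θ u := by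
  have hfirst : firstLevel N η = 0 := Nat.sInf_eq_zero.mpr (Or.inl h0)
  have hN0 : (0 : ℝ) ≤ N := Nat.cast_nonneg N
  have hmin : ∀ s, min (u * levelSize N η (s + 1)) N ≤ coordCount N η u s := fun s => by
    unfold coordCount
    split_ifs
    · exact le_rfl
    · exact min_le_right _ _
  have hr : ∀ s, 0 ≤ u * (levelSize N η s : ℝ) := fun s =>
    mul_nonneg (by linarith) (Nat.cast_nonneg _)
  have hcase : ∀ t ∈ V, ∀ s, √(sumLargest (fun i => (inner ℝ (increment π s t) (X i)) ^ 2)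
      (u * levelSize N η (s + 1))) ≤ b s := fun t ht s =>
    sqrt_sumLargest_sq_le (hr _) (hb s) fun J hJ => hX t ht s J (hJ.trans (hmin s))
  intro t ht
  refine ⟨fun s _ _ => (hcase t ht s).trans (hbθ s _), fun s hs => ?_, ?_⟩
  · refine (sqrt_sumLargest_sq_le hN0 (hb s) fun J hJ => hX t ht s J ?_).trans (hbθ s _)
    rw [min_self] at hJ
    rwa [coordCount, if_neg (not_le.mpr hs)]
  · rw [hfirst]
    exact (hcase t ht 0).trans (hbθ 0 _)

/-! ### Union bound and conclusion. -/

/-- The vectors `Δ_s t`, `t` in the unit ball. -/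
lemma exists_finset_increments {n : ℕ} (hn : 1 ≤ n) (s₁ s : ℕ) :
    ∃ D : Finset (EuclideanSpace ℝ (Fin n)),
      (∀ v, v ∈ D ↔ ∃ t ∈ Metric.closedBall (0 : EuclideanSpace ℝ (Fin n)) 1,
        v = increment (ballProj n s₁) s t) ∧
      (D.card : ℝ) ≤ Real.exp (2 * eta 10 n s₁ s) := by
  classical
  have hadm := isAdmissible_ball hn s₁
  have hη := eta_pos n s₁ s
  have h2 : ∀ y : ℝ, 0 ≤ y → (2 : ℝ) ^ y ≤ Real.exp y := fun y hy => by
    rw [Real.rpow_def_of_pos two_pos]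
    refine Real.exp_le_exp.mpr ?_
    have := Real.log_two_lt_d9
    nlinarith
  obtain ⟨B, hB, hBc⟩ : ∃ B : Finset (EuclideanSpace ℝ (Fin n)),
      (∀ t ∈ Metric.closedBall (0 : EuclideanSpace ℝ (Fin n)) 1,
        increment (ballProj n s₁) s t ∈ B) ∧ (B.card : ℝ) ≤ Real.exp (2 * eta 10 n s₁ s) := by
    cases s with
    | zero =>
      refine ⟨ballNet n s₁ 0, fun t ht => hadm.maps_to 0 t ht, (hadm.card_le 0).trans ?_⟩
      exact (h2 _ hη.le).trans (Real.exp_le_exp.mpr (by linarith))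
    | succ s =>
      refine ⟨(ballNet n s₁ (s + 1) ×ˢ ballNet n s₁ s).image fun z => z.1 - z.2,
        fun t ht => Finset.mem_image.mpr ⟨(ballProj n s₁ (s + 1) t, ballProj n s₁ s t),
          Finset.mem_product.mpr ⟨hadm.maps_to _ t ht, hadm.maps_to _ t ht⟩, rfl⟩, ?_⟩
      have hcard : (((ballNet n s₁ (s + 1) ×ˢ ballNet n s₁ s).image fun z => z.1 - z.2).card : ℝ) ≤
          (ballNet n s₁ (s + 1)).card * (ballNet n s₁ s).card := by
        rw [← Nat.cast_mul, ← Finset.card_product]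
        exact Nat.cast_le.mpr Finset.card_image_le
      have hmono := eta_le_eta_succ hn s₁ s
      calc _ ≤ _ := hcard
        _ ≤ Real.exp (eta 10 n s₁ (s + 1)) * Real.exp (eta 10 n s₁ (s + 1)) := by
            gcongr
            · exact (hadm.card_le _).trans (h2 _ hη.le)
            · exact ((hadm.card_le _).trans (h2 _ (eta_pos n s₁ s).le)).trans
                (Real.exp_le_exp.mpr hmono)
        _ = _ := by rw [← Real.exp_add]; congr 1; ring
  -- `B` holds all differences of net points, but the variance bound is available only for
  -- differences arising from one common `t`.
  refine ⟨B.filter fun v => ∃ t ∈ Metric.closedBall (0 : EuclideanSpace ℝ (Fin n)) 1,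
    v = increment (ballProj n s₁) s t, fun v => ?_,
    (Nat.cast_le.mpr (Finset.card_filter_le _ _)).trans hBc⟩
  rw [Finset.mem_filter, and_iff_right_iff_imp]
  rintro ⟨t, ht, rfl⟩
  exact hB t ht

lemma tsum_exp_eta_le (n s₁ : ℕ) :
    ∑' s, ENNReal.ofReal (Real.exp (-4 * eta 10 n s₁ s)) ≤
      ENNReal.ofReal (Real.exp (-2 * 2 ^ s₁)) := by
  have hterm : ∀ s, Real.exp (-4 * eta 10 n s₁ s) ≤
      Real.exp (-2 * 2 ^ s₁) * (1 / 2 / 2 ^ s) := by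
    intro s
    have h1 := le_eta n s₁ s
    have h2 : (1 : ℝ) ≤ 2 ^ s₁ := one_le_pow₀ one_le_two
    have h3 : (s : ℝ) + 1 ≤ 2 ^ s := by exact_mod_cast Nat.lt_two_pow_self
    have h4 : (2 : ℝ) ^ (s + s₁) = 2 ^ s * 2 ^ s₁ := pow_add _ _ _
    have hlog := Real.log_two_lt_d9
    have h5 : (1 / 2 / 2 ^ s : ℝ) = Real.exp (-((s + 1) * Real.log 2)) := by
      have : ((s : ℝ) + 1) * Real.log 2 = ((s + 1 : ℕ) : ℝ) * Real.log 2 := by push_cast; ring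
      rw [Real.exp_neg, this, Real.exp_nat_mul, Real.exp_log two_pos, pow_succ]
      field_simp
    rw [h5, ← Real.exp_add]
    refine Real.exp_le_exp.mpr ?_
    have h6 : (s + 1 : ℝ) * Real.log 2 ≤ s + 1 := by
      have : (0 : ℝ) ≤ s := Nat.cast_nonneg s
      nlinarith
    nlinarith
  calc _ ≤ ∑' s, ENNReal.ofReal (Real.exp (-2 * 2 ^ s₁) * (1 / 2 / 2 ^ s)) :=
        ENNReal.tsum_le_tsum fun s => ENNReal.ofReal_le_ofReal (hterm s)
    _ = ENNReal.ofReal (∑' s : ℕ, Real.exp (-2 * 2 ^ s₁) * (1 / 2 / 2 ^ s)) :=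
        (ENNReal.ofReal_tsum_of_nonneg (fun s => by positivity)
          ((summable_geometric_two' 1).mul_left _)).symm
    _ = _ := by rw [tsum_mul_left, tsum_geometric_two', mul_one]

/-- The bad event has exponentially small outer measure. -/
lemma measure_compl_eventOne_le {n N s₁ : ℕ} (hn : 1 ≤ n) (hN : 1 ≤ N) {p κ u : ℝ} (hp : 2 < p)
    (hκ : 0 < κ) (hu : 1 ≤ u) {μ : Measure (EuclideanSpace ℝ (Fin n))} [IsProbabilityMeasure μ]
    (hμ : IsUnconditional μ) (hd : HasSmallDiameter μ p κ)
    (h0 : Real.log (Real.exp 1 * N) ≤ eta 10 n s₁ 0) :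
    Measure.pi (fun _ : Fin N => μ)
      (eventOne N (eta 10 n s₁) (Metric.closedBall 0 1) (ballProj n s₁)
        (theta (√5120 * κ) 10 p n s₁ u) u)ᶜ ≤ ENNReal.ofReal (Real.exp (-2 * 2 ^ s₁)) := by
  choose D hD hDc using exists_finset_increments hn s₁
  -- `5120 = 10 * 4 * 128` makes `b² / (4q) = 10uη`. The choice of `J` costs `4uη`, leaving `6uη ≥
  -- 6η`; the `exp (2η)` increments then leave `exp (-4η)` per level.
  set b : ℕ → ℝ := fun s => √5120 * κ * √u * √(eta 10 n s₁ s) * widthBound p n s₁ s with hb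
  have hc : 0 < √5120 * κ := by positivity
  have hb0 : ∀ s, 0 ≤ b s := fun s => mul_nonneg (by positivity) (widthBound_pos hn s₁ s).le
  let bad (s : ℕ) (v : EuclideanSpace ℝ (Fin n)) : Set (Fin N → EuclideanSpace ℝ (Fin n)) :=
    {X | ∃ J : Finset (Fin N), (J.card : ℝ) ≤ coordCount N (eta 10 n s₁) u s ∧
      b s ^ 2 < ∑ j ∈ J, (inner ℝ v (X j)) ^ 2}
  have hsub : (eventOne N (eta 10 n s₁) (Metric.closedBall 0 1) (ballProj n s₁)
      (theta (√5120 * κ) 10 p n s₁ u) u)ᶜ ⊆ ⋃ s, ⋃ v ∈ D s, bad s v := by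
    rw [Set.compl_subset_comm]
    intro X hX
    refine mem_eventOne_of_forall hu h0 hb0
      (fun s v => le_theta hc hp n s₁ u s v) fun t ht s J hJ => ?_
    by_contra hlt
    refine hX (Set.mem_iUnion.mpr ⟨s, Set.mem_iUnion₂.mpr
      ⟨_, (hD s _).mpr ⟨t, ht, rfl⟩, J, hJ, not_le.mp hlt⟩⟩)
  have hbad : ∀ s, ∀ v ∈ D s, Measure.pi (fun _ : Fin N => μ) (bad s v) ≤
      ENNReal.ofReal (Real.exp (-6 * eta 10 n s₁ s)) := by
    intro s v hv
    obtain ⟨t, ht, rfl⟩ := (hD s v).mp hv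
    have hw := widthBound_pos (p := p) hn s₁ s
    have hη := eta_pos n s₁ s
    have hq : 0 < 128 * κ ^ 2 * widthBound p n s₁ s ^ 2 := by positivity
    obtain ⟨c1, c2, c3⟩ := coordCount_spec hN hu hη (eta_succ_le hn s₁ s)
      (h0.trans (eta_mono hn s₁ (Nat.zero_le (s + 1))))
    refine (measure_exists_sum_sq_le hμ _ hq ?_ c1 c2 (b s ^ 2)).trans ?_
    · filter_upwards [hd] with x hx
      exact sum_increment_sq_le hn hp hκ s₁ s ht hx
    · refine ENNReal.ofReal_le_ofReal (Real.exp_le_exp.mpr ?_)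
      have e : b s ^ 2 / (4 * (128 * κ ^ 2 * widthBound p n s₁ s ^ 2)) =
          10 * (u * eta 10 n s₁ s) := by
        simp only [hb, mul_pow]
        rw [Real.sq_sqrt (by norm_num), Real.sq_sqrt (by linarith), Real.sq_sqrt hη.le]
        field_simp
        norm_num
      rw [e]
      nlinarith
  calc _ ≤ _ := measure_mono hsub
    _ ≤ ∑' s, Measure.pi (fun _ : Fin N => μ) (⋃ v ∈ D s, bad s v) := measure_iUnion_le _
    _ ≤ ∑' s, ENNReal.ofReal (Real.exp (-4 * eta 10 n s₁ s)) := by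
        refine ENNReal.tsum_le_tsum fun s => ?_
        calc _ ≤ ∑ v ∈ D s, Measure.pi (fun _ : Fin N => μ) (bad s v) :=
              measure_biUnion_finset_le _ _
          _ ≤ ∑ v ∈ D s, ENNReal.ofReal (Real.exp (-6 * eta 10 n s₁ s)) :=
              Finset.sum_le_sum (hbad s)
          _ = ENNReal.ofReal ((D s).card * Real.exp (-6 * eta 10 n s₁ s)) := by
              rw [Finset.sum_const, nsmul_eq_mul, ENNReal.ofReal_mul (Nat.cast_nonneg _),
                ENNReal.ofReal_natCast]
          _ ≤ _ := by
              refine ENNReal.ofReal_le_ofReal ?_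
              calc _ ≤ Real.exp (2 * eta 10 n s₁ s) * Real.exp (-6 * eta 10 n s₁ s) := by
                    gcongr; exact hDc s
                _ = _ := by rw [← Real.exp_add]; congr 1; ring
    _ ≤ _ := tsum_exp_eta_le n s₁

theorem theorem5p2 :
    ∃ κ₄ : ℝ, 10 ≤ κ₄ ∧
    ∀ κ₁ p δ : ℝ, 0 < κ₁ → 2 < p → 0 < δ → δ < 1 / 2 - 1 / (2 * (p - 1)) →
    ∃ c c₁ c₂ c₃ : ℝ, 0 < c ∧ 0 < c₁ ∧ 0 < c₂ ∧ 0 < c₃ ∧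
    ∀ n s₁ : ℕ, 1 ≤ n → (n : ℝ) ^ δ / 2 ≤ (2 : ℝ) ^ s₁ → (2 : ℝ) ^ s₁ ≤ 2 * (n : ℝ) ^ δ →
    ∀ μ : Measure (EuclideanSpace ℝ (Fin n)), IsProbabilityMeasure μ →
      IsUnconditional μ → HasSmallDiameter μ p κ₁ →
    ∃ (T : ℕ → Finset (EuclideanSpace ℝ (Fin n)))
      (π : ℕ → EuclideanSpace ℝ (Fin n) → EuclideanSpace ℝ (Fin n)),
      IsAdmissible (eta κ₄ n s₁) (Metric.closedBall 0 1) T π ∧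
      ∀ u : ℝ, c₁ ≤ u →
        (∀ N : ℕ, 1 ≤ N → Real.log (Real.exp 1 * N) ≤ eta κ₄ n s₁ 0 →
          1 - Real.exp (-c₂ * (n : ℝ) ^ δ) ≤
            (Measure.pi (fun _ : Fin N => μ)).real
              (eventOne N (eta κ₄ n s₁) (Metric.closedBall 0 1) π
                (theta c κ₄ p n s₁ u) u)) ∧
        ∀ t ∈ Metric.closedBall (0 : EuclideanSpace ℝ (Fin n)) 1,
          Summable (fun s => theta c κ₄ p n s₁ u s (increment π s t)) ∧
          ∑' s, theta c κ₄ p n s₁ u s (increment π s t) ≤ c₃ * √u * √(n : ℝ) := by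
  refine ⟨10, le_rfl, fun κ p δ hκ hp _ hδ => ?_⟩
  have hc : 0 < √5120 * κ := by positivity
  obtain ⟨C, hC, hsum⟩ := tsum_theta_le hc hp hδ
  refine ⟨√5120 * κ, 1, 1, C, hc, one_pos, one_pos, hC, ?_⟩
  intro n s₁ hn hs hs' μ _ hμ hd
  refine ⟨ballNet n s₁, ballProj n s₁, isAdmissible_ball hn s₁, fun u hu => ⟨?_, fun t _ =>
    hsum n s₁ hn hs' u fun s => increment (ballProj n s₁) s t⟩⟩
  intro N hN h0
  set E := eventOne N (eta 10 n s₁) (Metric.closedBall 0 1) (ballProj n s₁)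
    (theta (√5120 * κ) 10 p n s₁ u) u with hE
  have hcompl : (Measure.pi (fun _ : Fin N => μ)).real Eᶜ ≤ Real.exp (-1 * (n : ℝ) ^ δ) := by
    refine (ENNReal.toReal_le_of_le_ofReal (Real.exp_pos _).le
      (measure_compl_eventOne_le hn hN hp hκ hu hμ hd h0)).trans ?_
    -- The lower bound on `2^(s₁)` gives `2 * 2^(s₁) ≥ n^δ`, hence `c₂ = 1`.
    exact Real.exp_le_exp.mpr (by linarith)
  -- Subadditivity suffices here, so the measurability of `E` is never needed.
  have htot : 1 ≤ (Measure.pi (fun _ : Fin N => μ)).real E +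
      (Measure.pi (fun _ : Fin N => μ)).real Eᶜ := by
    rw [← probReal_univ (μ := Measure.pi (fun _ : Fin N => μ)), ← Set.union_compl_self E]
    exact measureReal_union_le _ _
  linarith
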